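/- Let $\Gamma=(V,E,r,s)$ be a directed graph ($V,E$ arbitrary sets, $s,r:E\to V$ the source and range maps). The graph inverse semigroup $S$ of $\Gamma$ is the semigroup with zero generated by $V\cup E\cup\{e^*:e\in E\}$ subject to $uv=\delta_{u,v}u$, $s(e)e=er(e)=e$, $r(e)e^*=e^*s(e)=e^*$ and $f^*e=\delta_{f,e}r(e)$ for $u,v\in V$, $e,f\in E$. A cycle is a path $c=e_1\cdots e_n$, $n\ge 1$ (with $r(e_i)=s(e_{i+1})$), such that $r(e_n)=s(e_1)$ and the sources $s(e_1),\dots,s(e_n)$ are pairwise distinct; $s(c)=s(e_1)$. For $X\subseteq V$ let $C(X)$ be the set of cycles with $s(e_i)\in X$ for all $i$. A congruence triple of $\Gamma$ is a triple $(H,W,f)$ where $H\subseteq V$ is hereditary ($s(e)\in H$ implies $r(e)\in H$ for all $e\in E$), $W\subseteq V$ is such that for every $w\in W$ there is exactly one edge $e$ with $s(e)=w$ and $r(e)\notin H$, and $f:C(W)\to\mathbb{Z}^+\cup\{\infty\}$ is invariant under cyclic permutations of cycles; $f$ is extended to $C(V)$ by $f(c)=1$ for $c\in C(H)$ and $f(c)=\infty$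 for $c\notin C(H)\cup C(W)$. On the set $\mathcal{CT}(\Gamma)$ of congruence triples, put $(H_1,W_1,f_1)\le(H_2,W_2,f_2)$ if $H_1\subseteq H_2$, $W_1\setminus H_2\subseteq W_2$ and $f_2(c)\mid f_1(c)$ for all $c\in C(V)$, where every element of $\mathbb{Z}^+\cup\{\infty\}$ divides $\infty$ and $\infty$ divides only $\infty$; this is a partial order. Let $\mathcal{C}(S)$ be the set of congruences on $S$, ordered by inclusion. For $\rho\in\mathcal{C}(S)$ let $T(\rho)=(H,W,f)$, where $H=\{v\in V: v\,\rho\,0\}$, $W$ is the set of those $w\in V\setminus H$ for which there is an edge $e$ with $s(e)=w$, $r(e)\notin H$ and $ee^*\,\rho\,s(e)$, and, for $c\in C(W)$, $f(c)$ is the least positive integer $m$ with $c^m\,\rho\,s(c)$, or $\infty$ if there is none; this is a congruence triple. For $(H,W,f)\in\mathcal{CT}(\Gamma)$ let $\wp(H,W,f)$ be the congruence on $S$ generated by the pairs $(v,0)$ for $v\in H$, $(ee^*,s(e))$ for $e\in E$ with $s(e)\in W$ and $r(e)\notin H$, and $(c^{f(c)},s(c))$ for $c\in C(W)$ with $f(c)\in\mathbb{Z}^+$.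 Then $\wp:(\mathcal{CT}(\Gamma),\le)\to(\mathcal{C}(S),\subseteq)$ is an isomorphism of partially ordered sets, with inverse $T$. -/

import Mathlib

universe u v

/-- A directed graph with vertex set `V`, edge set `E`, source map `s` and range map `r`. -/
structure DirectedGraph (V : Type u) (E : Type v) where
  s : E → V
  r : E → V

namespace DirectedGraph

/-- The generating symbols: vertices `v`, edges `e` and formal inverses `e*`. -/
inductive Gen (V : Type u) (E : Type v) : Type (max u v)
  | vertex (v : V) : Gen V E
  | edge (e : E) : Gen V E
  | star (e : E) : Gen V E

/-- The free semigroup with zero on the generating symbols. -/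
abbrev FreeZero (V : Type u) (E : Type v) : Type (max u v) :=
  WithZero (FreeSemigroup (Gen V E))

/-- A generating symbol as an element of the free semigroup with zero. -/
def FreeZero.of {V : Type u} {E : Type v} (g : Gen V E) : FreeZero V E :=
  ((FreeSemigroup.of g : FreeSemigroup (Gen V E)) : WithZero (FreeSemigroup (Gen V E)))

/-- The defining relations of the graph inverse semigroup. -/
inductive DefRel {V : Type u} {E : Type v} (Γ : DirectedGraph V E) :
    FreeZero V E → FreeZero V E → Prop
  | vertex_mul_self (v : V) :
      DefRel Γ (FreeZero.of (.vertex v) * FreeZero.of (.vertex v)) (FreeZero.of (.vertex v))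
  | vertex_mul_ne (v w : V) (h : v ≠ w) :
      DefRel Γ (FreeZero.of (.vertex v) * FreeZero.of (.vertex w)) 0
  | source_mul_edge (e : E) :
      DefRel Γ (FreeZero.of (.vertex (Γ.s e)) * FreeZero.of (.edge e)) (FreeZero.of (.edge e))
  | edge_mul_range (e : E) :
      DefRel Γ (FreeZero.of (.edge e) * FreeZero.of (.vertex (Γ.r e))) (FreeZero.of (.edge e))
  | range_mul_star (e : E) :
      DefRel Γ (FreeZero.of (.vertex (Γ.r e)) * FreeZero.of (.star e)) (FreeZero.of (.star e))
  | star_mul_source (e : E) :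
      DefRel Γ (FreeZero.of (.star e) * FreeZero.of (.vertex (Γ.s e))) (FreeZero.of (.star e))
  | star_mul_self (e : E) :
      DefRel Γ (FreeZero.of (.star e) * FreeZero.of (.edge e)) (FreeZero.of (.vertex (Γ.r e)))
  | star_mul_ne (f e : E) (h : f ≠ e) :
      DefRel Γ (FreeZero.of (.star f) * FreeZero.of (.edge e)) 0

variable {V : Type u} {E : Type v} (Γ : DirectedGraph V E)

/-- The graph inverse semigroup of `Γ`: the semigroup with zero presented by the
generating symbols and the defining relations. -/
def InvSemigroup : Type (max u v) := (conGen Γ.DefRel).Quotient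

/-- The canonical projection from the free semigroup with zero. -/
def toInv (x : FreeZero V E) : Γ.InvSemigroup := ((x : (conGen Γ.DefRel).Quotient))

instance : Semigroup Γ.InvSemigroup :=
  inferInstanceAs (Semigroup (conGen Γ.DefRel).Quotient)

instance : Zero Γ.InvSemigroup := ⟨Γ.toInv 0⟩

theorem toInv_mul (x y : FreeZero V E) : Γ.toInv (x * y) = Γ.toInv x * Γ.toInv y := rfl

theorem toInv_eq {x y : FreeZero V E} (h : Γ.DefRel x y) : Γ.toInv x = Γ.toInv y :=
  (Con.eq _).2 (ConGen.Rel.of _ _ h)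

instance : SemigroupWithZero Γ.InvSemigroup where
  zero_mul a := by
    induction a using Con.induction_on with
    | H x => exact congrArg Γ.toInv (zero_mul x)
  mul_zero a := by
    induction a using Con.induction_on with
    | H x => exact congrArg Γ.toInv (mul_zero x)

/-- The vertex `v` as an element of the graph inverse semigroup. -/
def vert (v : V) : Γ.InvSemigroup := Γ.toInv (FreeZero.of (.vertex v))

/-- The edge `e` as an element of the graph inverse semigroup. -/
def edge (e : E) : Γ.InvSemigroup := Γ.toInv (FreeZero.of (.edge e))

/-- The element `e*` of the graph inverse semigroup. -/
def star (e : E) : Γ.InvSemigroup := Γ.toInv (FreeZero.of (.star e))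

/-- The product `e₁ e₂ ⋯ eₙ` of a nonempty sequence of edges. -/
def pathElem : E → List E → Γ.InvSemigroup
  | e, [] => Γ.edge e
  | e, f :: l => Γ.edge e * pathElem f l

/-- The power `x ^ m`, for a positive integer `m`, in a semigroup. -/
def ppow {S : Type*} [Semigroup S] (x : S) (m : ℕ+) : S := (fun y => x * y)^[m.natPred] x

/-- A cycle of `Γ`: a path `e₁ e₂ ⋯ eₙ` with `n ≥ 1`, `r(eₙ) = s(e₁)` and pairwise distinct
sources. -/
@[ext]
structure Cycle where
  first : E
  rest : List E
  chain : (first :: rest).IsChain (fun e f => Γ.r e = Γ.s f)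
  closed : Γ.r ((first :: rest).getLast (List.cons_ne_nil _ _)) = Γ.s first
  nodup : ((first :: rest).map Γ.s).Nodup

namespace Cycle

variable {Γ}

/-- The sequence of edges of a cycle. -/
def edges (c : Γ.Cycle) : List E := c.first :: c.rest

/-- The source `s(c)` of a cycle. -/
def source (c : Γ.Cycle) : V := Γ.s c.first

/-- The cycle as an element of the graph inverse semigroup. -/
def elem (c : Γ.Cycle) : Γ.InvSemigroup := Γ.pathElem c.first c.rest

/-- The cycle `c` has all its vertices in `X`. -/
def In (c : Γ.Cycle) (X : Set V) : Prop := ∀ e ∈ c.edges, Γ.s e ∈ X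

end Cycle

/-- Hereditary sets of vertices. -/
def Hereditary (H : Set V) : Prop := ∀ e : E, Γ.s e ∈ H → Γ.r e ∈ H

/-- The index of the vertex `v` relative to `H`. -/
noncomputable def relIndex (H : Set V) (v : V) : ℕ∞ := {e : E | Γ.s e = v ∧ Γ.r e ∉ H}.encard

/-- Divisibility on `ℤ⁺ ∪ {∞}`: everything divides `∞`, and `∞` divides only itself. -/
def ExtDvd (m n : WithTop ℕ+) : Prop := n = ⊤ ∨ ∃ a b : ℕ+, m = a ∧ n = b ∧ a ∣ b

/-- A congruence triple `(H, W, f)`, the cycle function on `W` being extended to all cycles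
by `1` on the cycles in `H` and by `∞` on the cycles that lie neither in `H` nor in `W`. -/
@[ext]
structure CongTriple where
  H : Set V
  W : Set V
  f : Γ.Cycle → WithTop ℕ+
  hereditary : Γ.Hereditary H
  index_one : ∀ w ∈ W, Γ.relIndex H w = 1
  f_cyclic : ∀ c d : Γ.Cycle, c.In W → d.In W → c.edges ~r d.edges → f c = f d
  f_H : ∀ c : Γ.Cycle, c.In H → f c = 1
  f_otherwise : ∀ c : Γ.Cycle, ¬ c.In H → ¬ c.In W → f c = ⊤

theorem ExtDvd.refl (m : WithTop ℕ+) : ExtDvd m m := by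
  induction m with
  | top => exact Or.inl rfl
  | coe a => exact Or.inr ⟨a, a, rfl, rfl, dvd_rfl⟩

theorem ExtDvd.trans {k m n : WithTop ℕ+} (h₁ : ExtDvd k m) (h₂ : ExtDvd m n) : ExtDvd k n := by
  rcases h₂ with rfl | ⟨a, b, rfl, rfl, hab⟩
  · exact Or.inl rfl
  · rcases h₁ with h | ⟨x, y, rfl, hy, hxy⟩
    · exact absurd h (WithTop.coe_ne_top)
    · obtain rfl := WithTop.coe_injective hy
      exact Or.inr ⟨x, b, rfl, rfl, hxy.trans hab⟩

theorem ExtDvd.antisymm {m n : WithTop ℕ+} (h₁ : ExtDvd m n) (h₂ : ExtDvd n m) : m = n := by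
  rcases h₂ with rfl | ⟨a, b, rfl, rfl, hab⟩
  · rcases h₁ with h | ⟨x, y, hx, _, _⟩
    · exact h.symm
    · exact absurd hx.symm WithTop.coe_ne_top
  · rcases h₁ with h | ⟨x, y, hx, hy, hxy⟩
    · exact absurd h WithTop.coe_ne_top
    · obtain rfl := WithTop.coe_injective hx
      obtain rfl := WithTop.coe_injective hy
      rw [PNat.dvd_antisymm hxy hab]

namespace CongTriple

variable {Γ}

theorem notMem_H (t : Γ.CongTriple) {w : V} (hw : w ∈ t.W) : w ∉ t.H := by
  intro hH
  obtain ⟨e, he⟩ := Set.encard_eq_one.1 (t.index_one w hw)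
  have h : e ∈ {e : E | Γ.s e = w ∧ Γ.r e ∉ t.H} := by rw [he]; rfl
  exact h.2 (t.hereditary e (by rw [h.1]; exact hH))

/-- The order on congruence triples. -/
instance : PartialOrder Γ.CongTriple where
  le t₁ t₂ := t₁.H ⊆ t₂.H ∧ t₁.W \ t₂.H ⊆ t₂.W ∧ ∀ c : Γ.Cycle, ExtDvd (t₂.f c) (t₁.f c)
  le_refl t := ⟨subset_rfl, Set.sdiff_subset, fun _ => ExtDvd.refl _⟩
  le_trans t₁ t₂ t₃ h₁ h₂ :=
    ⟨h₁.1.trans h₂.1,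
      fun _ hw => h₂.2.1 ⟨h₁.2.1 ⟨hw.1, fun h => hw.2 (h₂.1 h)⟩, hw.2⟩,
      fun c => (h₂.2.2 c).trans (h₁.2.2 c)⟩
  le_antisymm t₁ t₂ h₁ h₂ := by
    have hH : t₁.H = t₂.H := h₁.1.antisymm h₂.1
    refine CongTriple.ext hH (Set.Subset.antisymm ?_ ?_) ?_
    · exact fun w hw => h₁.2.1 ⟨hw, hH ▸ t₁.notMem_H hw⟩
    · exact fun w hw => h₂.2.1 ⟨hw, hH ▸ t₂.notMem_H hw⟩
    · exact funext fun c => (h₂.2.2 c).antisymm (h₁.2.2 c)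

/-- The generating pairs of the congruence associated with a congruence triple. -/
inductive GenRel (t : Γ.CongTriple) : Γ.InvSemigroup → Γ.InvSemigroup → Prop
  | vert_zero (v : V) (hv : v ∈ t.H) : GenRel t (Γ.vert v) 0
  | edge_star (e : E) (hs : Γ.s e ∈ t.W) (hr : Γ.r e ∉ t.H) :
      GenRel t (Γ.edge e * Γ.star e) (Γ.vert (Γ.s e))
  | cycle_pow (c : Γ.Cycle) (hc : c.In t.W) (m : ℕ+) (hm : t.f c = (m : WithTop ℕ+)) :
      GenRel t (ppow c.elem m) (Γ.vert c.source)

/-- The congruence `℘(H, W, f)` on the graph inverse semigroup. -/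
def toCon (t : Γ.CongTriple) : Con Γ.InvSemigroup := conGen t.GenRel

end CongTriple

/-! ### The congruence triple of a congruence -/

variable {Γ}

/-- The set `H` of the vertices that are congruent to `0`. -/
def conH (ρ : Con Γ.InvSemigroup) : Set V := {v | ρ (Γ.vert v) 0}

/-- The set `W` of the vertices `s(e)` outside `H` such that `r(e)` is outside `H` and `e e*`
is congruent to `s(e)`. -/
def conW (ρ : Con Γ.InvSemigroup) : Set V :=
  {w | w ∉ conH ρ ∧
    ∃ e : E, Γ.s e = w ∧ Γ.r e ∉ conH ρ ∧ ρ (Γ.edge e * Γ.star e) (Γ.vert (Γ.s e))}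

open Classical in
/-- The least positive integer with the property `p`, or `∞` if there is none. -/
noncomputable def leastOrTop (p : ℕ+ → Prop) : WithTop ℕ+ :=
  if h : ∃ m : ℕ+, p m then (PNat.find h : WithTop ℕ+) else ⊤

/-- The least positive `m` such that `c ^ m` is congruent to `s(c)`, or `∞` if there is none. -/
noncomputable def conOrder (ρ : Con Γ.InvSemigroup) (c : Γ.Cycle) : WithTop ℕ+ :=
  leastOrTop fun m => ρ (ppow c.elem m) (Γ.vert c.source)

open Classical in
/-- The cycle function of a congruence, extended to all cycles. -/
noncomputable def conF (ρ : Con Γ.InvSemigroup) (c : Γ.Cycle) : WithTop ℕ+ :=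
  if c.In (conH ρ) then 1 else if c.In (conW ρ) then conOrder ρ c else ⊤

theorem star_mul_edge (e : E) : Γ.star e * Γ.edge e = Γ.vert (Γ.r e) :=
  Γ.toInv_eq (.star_mul_self e)

theorem star_mul_edge_ne {f e : E} (h : f ≠ e) : Γ.star f * Γ.edge e = 0 :=
  Γ.toInv_eq (.star_mul_ne f e h)

theorem vert_mul_edge (e : E) : Γ.vert (Γ.s e) * Γ.edge e = Γ.edge e :=
  Γ.toInv_eq (.source_mul_edge e)

/-- Conjugating by an edge `e`. -/
theorem con_conj (ρ : Con Γ.InvSemigroup) (e : E) {x : Γ.InvSemigroup} (f : E)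
    (h : ρ x (Γ.vert (Γ.s e))) : ρ (Γ.star f * x * Γ.edge e) (Γ.star f * Γ.edge e) := by
  have := ρ.mul (ρ.mul (ρ.refl (Γ.star f)) h) (ρ.refl (Γ.edge e))
  rwa [mul_assoc _ (Γ.vert _), vert_mul_edge] at this

theorem conH_hereditary (ρ : Con Γ.InvSemigroup) : Γ.Hereditary (conH ρ) := by
  intro e he
  have h := con_conj ρ e e (ρ.refl (Γ.vert (Γ.s e)))
  have h0 := ρ.mul (ρ.mul (ρ.refl (Γ.star e)) he) (ρ.refl (Γ.edge e))
  rw [mul_zero, zero_mul] at h0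
  have := ρ.trans (ρ.symm h) h0
  rwa [star_mul_edge] at this

theorem conW_index (ρ : Con Γ.InvSemigroup) : ∀ w ∈ conW ρ, Γ.relIndex (conH ρ) w = 1 := by
  rintro w ⟨_, e, rfl, he, hρ⟩
  refine Set.encard_eq_one.2 ⟨e, Set.eq_singleton_iff_unique_mem.2 ⟨⟨rfl, he⟩, ?_⟩⟩
  rintro f ⟨hfs, hf⟩
  by_contra hne
  refine hf ?_
  have h := con_conj ρ f f (hfs.symm ▸ hρ)
  rw [← mul_assoc, star_mul_edge_ne hne, zero_mul, zero_mul, star_mul_edge] at h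
  exact ρ.symm h

theorem pathElem_append (e : E) (l : List E) (f : E) :
    Γ.pathElem e (l ++ [f]) = Γ.pathElem e l * Γ.edge f := by
  induction l generalizing e with
  | nil => rfl
  | cons a l ih => simp [pathElem, ih, mul_assoc]

theorem ppow_conj {S : Type*} [Semigroup S] (a b : S) (m : ℕ+) :
    ppow (a * b) m * a = a * ppow (b * a) m := by
  have key : ∀ n : ℕ, (fun y => a * b * y)^[n] (a * b) * a
      = a * (fun y => b * a * y)^[n] (b * a) := by
    intro n
    induction n with
    | zero => simp [mul_assoc]
    | succ n ih =>
      rw [Function.iterate_succ_apply', Function.iterate_succ_apply', mul_assoc, ih]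
      simp [mul_assoc]
  exact key m.natPred

theorem ppow_left {S : Type*} [Semigroup S] (u x : S) (h : u * x = x) (m : ℕ+) :
    u * ppow x m = ppow x m := by
  have key : ∀ n : ℕ, u * (fun y => x * y)^[n] x = (fun y => x * y)^[n] x := by
    intro n
    cases n with
    | zero => exact h
    | succ n => rw [Function.iterate_succ_apply', ← mul_assoc, h]
  exact key m.natPred

/-- Moving the first edge of a cycle to its end keeps the relation `c ^ m ρ s(c)`. -/
theorem con_rotate_one (ρ : Con Γ.InvSemigroup) (c d : Γ.Cycle) (h : d.edges = c.edges.rotate 1)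
    (m : ℕ+) (hc : ρ (ppow c.elem m) (Γ.vert c.source)) :
    ρ (ppow d.elem m) (Γ.vert d.source) := by
  obtain ⟨e, l, hch, hcl, hnd⟩ := c
  obtain ⟨e', l', hch', hcl', hnd'⟩ := d
  simp only [Cycle.edges, List.rotate_cons_succ, List.rotate_zero] at h
  simp only [Cycle.elem, Cycle.source] at hc ⊢
  cases l with
  | nil =>
    simp only [List.nil_append, List.cons.injEq] at h
    obtain ⟨rfl, rfl⟩ := h
    exact hc
  | cons a l =>
    simp only [List.cons_append, List.cons.injEq] at h
    obtain ⟨rfl, rfl⟩ := h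
    have hr : Γ.r e = Γ.s e' := (List.isChain_cons_cons.1 hch).1
    have h1 := con_conj ρ e e hc
    rw [star_mul_edge, hr] at h1
    have h2 : Γ.vert (Γ.s e') * ppow (Γ.pathElem e' (l ++ [e])) m
        = ppow (Γ.pathElem e' (l ++ [e])) m := by
      apply ppow_left
      rw [pathElem_append]
      cases l with
      | nil => rw [pathElem, ← mul_assoc, vert_mul_edge]
      | cons b l => rw [pathElem, ← mul_assoc, ← mul_assoc, vert_mul_edge]
    have h3 : Γ.star e * ppow (Γ.pathElem e (e' :: l)) m * Γ.edge e
        = ppow (Γ.pathElem e' (l ++ [e])) m := by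
      rw [pathElem, mul_assoc, ppow_conj, ← pathElem_append, ← mul_assoc, star_mul_edge, hr, h2]
    rwa [h3] at h1

/-- The rotation of a cycle by one edge. -/
theorem exists_rotate_one (c : Γ.Cycle) : ∃ d : Γ.Cycle, d.edges = c.edges.rotate 1 := by
  obtain ⟨e, l, hch, hcl, hnd⟩ := c
  cases l with
  | nil => exact ⟨⟨e, [], hch, hcl, hnd⟩, by simp [Cycle.edges]⟩
  | cons a l =>
    have hr : Γ.r e = Γ.s a := (List.isChain_cons_cons.1 hch).1
    refine ⟨⟨a, l ++ [e], ?_, ?_, ?_⟩, by simp [Cycle.edges]⟩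
    · have h := (List.isChain_cons_cons.1 hch).2
      have := List.IsChain.append h (List.isChain_singleton e) (by
        intro x hx y hy
        rw [List.getLast?_eq_getLast_of_ne_nil (List.cons_ne_nil _ _)] at hx
        simp only [Option.mem_def, Option.some.injEq, List.head?_cons] at hx hy
        subst hx hy
        rw [← hcl, List.getLast_cons (List.cons_ne_nil _ _)])
      simpa using this
    · simpa using hr
    · have : ((a :: (l ++ [e])).map Γ.s).Perm ((e :: a :: l).map Γ.s) := by
        refine List.Perm.map _ ?_
        exact List.perm_append_singleton e (a :: l)
      exact this.nodup_iff.2 hnd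

theorem con_rotate (ρ : Con Γ.InvSemigroup) (n : ℕ) (c d : Γ.Cycle)
    (h : d.edges = c.edges.rotate n) (m : ℕ+) (hc : ρ (ppow c.elem m) (Γ.vert c.source)) :
    ρ (ppow d.elem m) (Γ.vert d.source) := by
  induction n generalizing c with
  | zero =>
    simp only [List.rotate_zero, Cycle.edges, List.cons.injEq] at h
    obtain rfl := Cycle.ext h.1 h.2
    exact hc
  | succ n ih =>
    obtain ⟨c', hc'⟩ := exists_rotate_one c
    refine ih c' ?_ (con_rotate_one ρ c c' hc' m hc)
    rw [h, hc', List.rotate_rotate, add_comm]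

theorem conOrder_cyclic (ρ : Con Γ.InvSemigroup) (c d : Γ.Cycle) (h : c.edges ~r d.edges) :
    conOrder ρ c = conOrder ρ d := by
  have key : (fun m : ℕ+ => ρ (ppow c.elem m) (Γ.vert c.source))
      = fun m : ℕ+ => ρ (ppow d.elem m) (Γ.vert d.source) := by
    funext m
    refine propext ⟨fun hc => ?_, fun hd => ?_⟩
    · obtain ⟨n, hn⟩ := h
      exact con_rotate ρ n c d hn.symm m hc
    · obtain ⟨n, hn⟩ := h.symm
      exact con_rotate ρ n d c hn.symm m hd
  exact congrArg leastOrTop key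

variable (Γ)

/-- The congruence triple `T(ρ)` of a congruence `ρ`. -/
noncomputable def toTriple (ρ : Con Γ.InvSemigroup) : Γ.CongTriple where
  H := conH ρ
  W := conW ρ
  f := conF ρ
  hereditary := conH_hereditary ρ
  index_one := conW_index ρ
  f_cyclic c d hc hd h := by
    have hH : ∀ x : Γ.Cycle, x.In (conW ρ) → ¬ x.In (conH ρ) := fun x hx hx' =>
      (hx x.first List.mem_cons_self).1 (hx' x.first List.mem_cons_self)
    simp only [conF, hH c hc, hH d hd, hc, hd, if_true, if_false]
    exact conOrder_cyclic ρ c d h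
  f_H c hc := by simp [conF, hc]
  f_otherwise c hH hW := by simp [conF, hH, hW]

end DirectedGraph

namespace DirectedGraph

variable {V : Type u} {E : Type v} {Γ : DirectedGraph V E}

/-! ### Walks and the normal form of elements -/

/-! The maps `toCon` and `toTriple` are both monotone, so it is enough that they are mutually
inverse.

`toCon_toTriple`: the generating pairs attached to T(ρ) lie in ρ. Conversely, every element is 0 or
pq* with walks p, q of equal range. Let pq* ρ xy*, neither side congruent to 0. Multiplying by p* on
the left and q on the right gives w ρ p*xy*q for the common range w of p and q. As w is not
congruent to 0, p and x are prefix-comparable, and so are q and y. This leaves a vertex congruent to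
ab* or to a closed walk. Comparing first edges puts the vertices met into W. A closed walk inside W
is a power of a cycle c, with exponent a multiple of the order of c modulo ρ, so the pair already
follows from the generators.

`toTriple_toCon`: it must be shown that ℘(H, W, f) identifies nothing unexpected, which takes a
model (`exists_weighted_action`). The semigroup acts on boundary paths paired with an abelian group
G: an edge prepends itself and adds its weight. A vertex outside H has a boundary path, so it is not
0. A vertex outside W has a path that stops there, on which ee* is undefined. At the source of a
cycle c in W there is just one boundary path, so c acts by a translation of G; for G = ℤ/n and
weight 1 on the first edge of c, `dvd_of_toCon_ppow` bounds the order of c from below. -/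

theorem vert_mul_vert (v : V) : Γ.vert v * Γ.vert v = Γ.vert v :=
  Γ.toInv_eq (.vertex_mul_self v)

theorem vert_mul_vert_ne {v w : V} (h : v ≠ w) : Γ.vert v * Γ.vert w = 0 :=
  Γ.toInv_eq (.vertex_mul_ne v w h)

theorem edge_mul_vert (e : E) : Γ.edge e * Γ.vert (Γ.r e) = Γ.edge e :=
  Γ.toInv_eq (.edge_mul_range e)

theorem vert_mul_star (e : E) : Γ.vert (Γ.r e) * Γ.star e = Γ.star e :=
  Γ.toInv_eq (.range_mul_star e)

theorem star_mul_vert (e : E) : Γ.star e * Γ.vert (Γ.s e) = Γ.star e :=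
  Γ.toInv_eq (.star_mul_source e)

variable (Γ) in
/-- The list of edges `l` is a walk from `v` to `w`. -/
def IsWalk : V → List E → V → Prop
  | v, [], w => v = w
  | v, e :: l, w => Γ.s e = v ∧ IsWalk (Γ.r e) l w

variable (Γ) in
/-- The element of the graph inverse semigroup given by a walk starting at `v`. -/
def walkElem : V → List E → Γ.InvSemigroup
  | v, [] => Γ.vert v
  | _, e :: l => Γ.edge e * walkElem (Γ.r e) l

variable (Γ) in
/-- The inverse of the element given by a walk starting at `v`. -/
def walkStar : V → List E → Γ.InvSemigroup
  | v, [] => Γ.vert v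
  | _, e :: l => walkStar (Γ.r e) l * Γ.star e

theorem pathElem_eq_walkElem (v : V) (e : E) (l : List E) :
    Γ.pathElem e l = Γ.walkElem v (e :: l) := by
  induction l generalizing e v with
  | nil => simp [pathElem, walkElem, edge_mul_vert]
  | cons f l ih => rw [pathElem, ih (Γ.r e)]; rfl

theorem vert_mul_walkElem {v w : V} {l : List E} (h : Γ.IsWalk v l w) :
    Γ.vert v * Γ.walkElem v l = Γ.walkElem v l := by
  cases l with
  | nil => exact vert_mul_vert v
  | cons e l =>
    obtain ⟨rfl, -⟩ := h
    rw [walkElem, ← mul_assoc, vert_mul_edge]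

theorem walkStar_mul_vert {v w : V} {l : List E} (h : Γ.IsWalk v l w) :
    Γ.walkStar v l * Γ.vert v = Γ.walkStar v l := by
  cases l with
  | nil => exact vert_mul_vert v
  | cons e l =>
    obtain ⟨rfl, -⟩ := h
    rw [walkStar, mul_assoc, star_mul_vert]

theorem walkElem_mul_vert {v w : V} {l : List E} (h : Γ.IsWalk v l w) :
    Γ.walkElem v l * Γ.vert w = Γ.walkElem v l := by
  induction l generalizing v with
  | nil => obtain rfl := h; exact vert_mul_vert v
  | cons e l ih => rw [walkElem, mul_assoc, ih h.2]

theorem vert_mul_walkStar {v w : V} {l : List E} (h : Γ.IsWalk v l w) :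
    Γ.vert w * Γ.walkStar v l = Γ.walkStar v l := by
  induction l generalizing v with
  | nil => obtain rfl := h; exact vert_mul_vert v
  | cons e l ih => rw [walkStar, ← mul_assoc, ih h.2]

theorem walkStar_mul_walkElem {v w : V} {l : List E} (h : Γ.IsWalk v l w) :
    Γ.walkStar v l * Γ.walkElem v l = Γ.vert w := by
  induction l generalizing v with
  | nil => obtain rfl := h; exact vert_mul_vert v
  | cons e l ih =>
    rw [walkStar, walkElem, mul_assoc, ← mul_assoc (Γ.star e), star_mul_edge,
      vert_mul_walkElem h.2, ih h.2]

theorem isWalk_append {u w : V} {a b : List E} :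
    Γ.IsWalk u (a ++ b) w ↔ ∃ v, Γ.IsWalk u a v ∧ Γ.IsWalk v b w := by
  induction a generalizing u with
  | nil => simp [IsWalk]
  | cons e a ih => simp [IsWalk, ih, and_assoc]

theorem IsWalk.target_unique {u v w : V} {a : List E} (h : Γ.IsWalk u a v)
    (h' : Γ.IsWalk u a w) : v = w := by
  induction a generalizing u with
  | nil => exact h.symm.trans h'
  | cons e a ih => exact ih h.2 h'.2

theorem IsWalk.of_append {u v w : V} {a b : List E} (h : Γ.IsWalk u a v)
    (h' : Γ.IsWalk u (a ++ b) w) : Γ.IsWalk v b w := by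
  obtain ⟨v', h1, h2⟩ := isWalk_append.1 h'
  rwa [h.target_unique h1]

theorem walkElem_append {u v w : V} {a b : List E} (h : Γ.IsWalk u a v) (h' : Γ.IsWalk v b w) :
    Γ.walkElem u (a ++ b) = Γ.walkElem u a * Γ.walkElem v b := by
  induction a generalizing u with
  | nil => obtain rfl := h; exact (vert_mul_walkElem h').symm
  | cons e a ih => rw [List.cons_append, walkElem, ih h.2, walkElem, mul_assoc]

theorem walkStar_append {u v w : V} {a b : List E} (h : Γ.IsWalk u a v) (h' : Γ.IsWalk v b w) :
    Γ.walkStar u (a ++ b) = Γ.walkStar v b * Γ.walkStar u a := by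
  induction a generalizing u with
  | nil => obtain rfl := h; exact (walkStar_mul_vert h').symm
  | cons e a ih => rw [List.cons_append, walkStar, ih h.2, walkStar, mul_assoc]

/-- Either two walks are comparable as prefixes, or the product of the inverse of one with the
other is zero. -/
theorem walkStar_mul_walkElem_eq_zero_or {u u' w w' : V} {a c : List E} (ha : Γ.IsWalk u a w)
    (hc : Γ.IsWalk u' c w') : Γ.walkStar u a * Γ.walkElem u' c = 0 ∨
      (u = u' ∧ ((∃ t, c = a ++ t) ∨ ∃ t, a = c ++ t)) := by
  by_cases huu : u = u'
  swap
  · left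
    rw [← walkStar_mul_vert ha, ← vert_mul_walkElem hc, mul_assoc, ← mul_assoc (Γ.vert u),
      vert_mul_vert_ne huu, zero_mul, mul_zero]
  subst huu
  induction a generalizing u c with
  | nil => exact Or.inr ⟨rfl, Or.inl ⟨c, rfl⟩⟩
  | cons e a ih =>
    cases c with
    | nil => exact Or.inr ⟨rfl, Or.inr ⟨_, rfl⟩⟩
    | cons f c =>
      by_cases hef : e = f
      · subst hef
        rcases ih ha.2 hc.2 with h | ⟨-, ⟨t, ht⟩ | ⟨t, ht⟩⟩
        · left
          rw [walkStar, walkElem, mul_assoc, ← mul_assoc (Γ.star e), star_mul_edge,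
            vert_mul_walkElem hc.2, h]
        · exact Or.inr ⟨rfl, Or.inl ⟨t, by rw [ht]; rfl⟩⟩
        · exact Or.inr ⟨rfl, Or.inr ⟨t, by rw [ht]; rfl⟩⟩
      · left
        rw [walkStar, walkElem, mul_assoc, ← mul_assoc (Γ.star e), star_mul_edge_ne hef,
          zero_mul, mul_zero]

variable (Γ) in
/-- The zero element and the elements `p q*` for walks `p` and `q` with the same range. -/
def IsNormal (x : Γ.InvSemigroup) : Prop :=
  x = 0 ∨ ∃ (u v w : V) (a b : List E), Γ.IsWalk u a w ∧ Γ.IsWalk v b w ∧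
    x = Γ.walkElem u a * Γ.walkStar v b

theorem IsNormal.vert_mul (v : V) {x : Γ.InvSemigroup} (hx : Γ.IsNormal x) :
    Γ.IsNormal (Γ.vert v * x) := by
  rcases hx with rfl | ⟨u, v', w, a, b, ha, hb, rfl⟩
  · exact Or.inl (mul_zero _)
  by_cases h : v = u
  · subst h
    rw [← mul_assoc, vert_mul_walkElem ha]
    exact Or.inr ⟨_, _, _, _, _, ha, hb, rfl⟩
  · left
    rw [← vert_mul_walkElem ha, ← mul_assoc, ← mul_assoc, vert_mul_vert_ne h, zero_mul, zero_mul]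

theorem IsNormal.edge_mul (e : E) {x : Γ.InvSemigroup} (hx : Γ.IsNormal x) :
    Γ.IsNormal (Γ.edge e * x) := by
  rcases hx with rfl | ⟨u, v', w, a, b, ha, hb, rfl⟩
  · exact Or.inl (mul_zero _)
  by_cases h : Γ.r e = u
  · subst h
    exact Or.inr ⟨Γ.s e, _, _, e :: a, _, ⟨rfl, ha⟩, hb, by rw [walkElem, mul_assoc]⟩
  · left
    rw [← vert_mul_walkElem ha, ← edge_mul_vert, ← mul_assoc, ← mul_assoc, mul_assoc (Γ.edge e),
      vert_mul_vert_ne h, mul_zero, zero_mul, zero_mul]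

theorem IsNormal.star_mul (e : E) {x : Γ.InvSemigroup} (hx : Γ.IsNormal x) :
    Γ.IsNormal (Γ.star e * x) := by
  rcases hx with rfl | ⟨u, v', w, a, b, ha, hb, rfl⟩
  · exact Or.inl (mul_zero _)
  by_cases h : Γ.s e = u
  · subst h
    cases a with
    | nil =>
      obtain rfl := ha
      refine Or.inr ⟨Γ.r e, v', Γ.r e, [], b ++ [e], rfl,
        isWalk_append.2 ⟨_, hb, rfl, rfl⟩, ?_⟩
      rw [walkStar_append hb (b := [e]) (w := Γ.r e) ⟨rfl, rfl⟩]
      simp only [walkElem, walkStar]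
      rw [← mul_assoc, ← mul_assoc, ← mul_assoc, star_mul_vert, vert_mul_vert, vert_mul_star]
    | cons f a =>
      by_cases hef : e = f
      · subst hef
        refine Or.inr ⟨_, _, _, _, _, ha.2, hb, ?_⟩
        rw [walkElem, ← mul_assoc, ← mul_assoc, star_mul_edge, vert_mul_walkElem ha.2]
      · left
        rw [walkElem, ← mul_assoc, ← mul_assoc, star_mul_edge_ne hef, zero_mul, zero_mul]
  · left
    rw [← vert_mul_walkElem ha, ← star_mul_vert, ← mul_assoc, ← mul_assoc, mul_assoc (Γ.star e),
      vert_mul_vert_ne h, mul_zero, zero_mul, zero_mul]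

theorem isNormal_vert (v : V) : Γ.IsNormal (Γ.vert v) :=
  Or.inr ⟨v, v, v, [], [], rfl, rfl, (vert_mul_vert v).symm⟩

/-- The normal elements contain the generators and are stable under left multiplication by
generators, so induction on words applies. -/
theorem isNormal (x : Γ.InvSemigroup) : Γ.IsNormal x := by
  induction x using Con.induction_on with
  | H x =>
    change Γ.IsNormal (Γ.toInv x)
    induction x using WithZero.recZeroCoe with
    | zero => exact Or.inl rfl
    | coe x =>
      induction x using FreeSemigroup.recOnMul with
      | ih1 g =>
        cases g with
        | vertex v => exact isNormal_vert v
        | edge e =>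
          have := (isNormal_vert (Γ := Γ) (Γ.r e)).edge_mul e
          rwa [edge_mul_vert] at this
        | star e =>
          have := (isNormal_vert (Γ := Γ) (Γ.s e)).star_mul e
          rwa [star_mul_vert] at this
      | ih2 g y _ ih =>
        cases g with
        | vertex v => exact ih.vert_mul v
        | edge e => exact ih.edge_mul e
        | star e => exact ih.star_mul e

/-! ### Closed walks and cycles -/

theorem isWalk_cons_iff {e : E} {l : List E} {w : V} :
    Γ.IsWalk (Γ.s e) (e :: l) w ↔ (e :: l).IsChain (fun e f => Γ.r e = Γ.s f) ∧
      Γ.r ((e :: l).getLast (List.cons_ne_nil _ _)) = w := by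
  induction l generalizing e with
  | nil => simp [IsWalk]
  | cons f l ih =>
    rw [List.isChain_cons_cons, List.getLast_cons (List.cons_ne_nil _ _), and_assoc, ← ih]
    simp only [IsWalk, true_and]
    rw [eq_comm]

theorem Cycle.isWalk (c : Γ.Cycle) : Γ.IsWalk c.source c.edges c.source :=
  isWalk_cons_iff.2 ⟨c.chain, c.closed⟩

theorem Cycle.elem_eq (c : Γ.Cycle) : c.elem = Γ.walkElem c.source c.edges :=
  pathElem_eq_walkElem _ _ _

theorem IsWalk.range_eq_or {v w : V} {l : List E} (h : Γ.IsWalk v l w) {e : E} (he : e ∈ l) :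
    Γ.r e = w ∨ ∃ f ∈ l, Γ.s f = Γ.r e := by
  induction l generalizing v with
  | nil => simp at he
  | cons g l ih =>
    rcases List.mem_cons.1 he with rfl | he
    · cases l with
      | nil => exact Or.inl h.2
      | cons f l => exact Or.inr ⟨f, by simp, h.2.1⟩
    · rcases ih h.2 he with h | ⟨f, hf, hs⟩
      · exact Or.inl h
      · exact Or.inr ⟨f, List.mem_cons_of_mem _ hf, hs⟩

/-- For a closed walk with sources in W this keeps all ranges outside H, so each edge is the unique
admissible one at its source. -/
theorem IsWalk.exists_source_eq_range {v : V} {l : List E} (h : Γ.IsWalk v l v) {e : E}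
    (he : e ∈ l) : ∃ f ∈ l, Γ.s f = Γ.r e := by
  rcases h.range_eq_or he with hr | hr
  · cases l with
    | nil => simp at he
    | cons f l => exact ⟨f, by simp, by rw [hr, h.1]⟩
  · exact hr

/-! ### Powers, and walks driven by a choice of outgoing edge. -/

theorem ppow_one {S : Type*} [Semigroup S] (x : S) : ppow x 1 = x := rfl

theorem ppow_succ {S : Type*} [Semigroup S] (x : S) (m : ℕ+) : ppow x (m + 1) = x * ppow x m := by
  have : (m + 1).natPred = m.natPred + 1 := by
    have := PNat.natPred_add_one m
    have h := PNat.natPred_add_one (m + 1)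
    rw [PNat.add_coe, PNat.one_coe] at h
    omega
  rw [ppow, this, Function.iterate_succ_apply']
  rfl

/-- The first `n` edges followed from `v` when the edge `nxt x` is taken at each vertex `x`. -/
def followList (Γ : DirectedGraph V E) (nxt : V → E) : ℕ → V → List E
  | 0, _ => []
  | n + 1, v => nxt v :: followList Γ nxt n (Γ.r (nxt v))

section follow

variable {nxt : V → E}

theorem followList_add (m n : ℕ) (v : V) : Γ.followList nxt (m + n) v =
    Γ.followList nxt m v ++ Γ.followList nxt n ((Γ.r ∘ nxt)^[m] v) := by
  induction m generalizing v with
  | zero => simp [followList]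
  | succ m ih => rw [Nat.succ_add, followList, ih]; rfl

/-- A walk obeying `nxt` is determined by its start and length; if closed, its start is a periodic
point of `Γ.r ∘ nxt`. -/
theorem IsWalk.eq_followList {v w : V} {l : List E} (h : Γ.IsWalk v l w)
    (hl : ∀ e ∈ l, e = nxt (Γ.s e)) :
    l = Γ.followList nxt l.length v ∧ w = (Γ.r ∘ nxt)^[l.length] v := by
  induction l generalizing v with
  | nil => exact ⟨rfl, h.symm⟩
  | cons e l ih =>
    obtain ⟨rfl, h⟩ := h
    have he : nxt (Γ.s e) = e := (hl e (by simp)).symm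
    obtain ⟨h1, h2⟩ := ih h (fun f hf => hl f (List.mem_cons_of_mem _ hf))
    refine ⟨?_, ?_⟩
    · rw [List.length_cons, followList, he, ← h1]
    · rw [List.length_cons, Function.iterate_succ_apply, Function.comp_apply, he]
      exact h2

theorem isWalk_followList {U : Set V} (hs : ∀ v ∈ U, Γ.s (nxt v) = v)
    (hr : ∀ v ∈ U, Γ.r (nxt v) ∈ U) (n : ℕ) {v : V} (hv : v ∈ U) :
    Γ.IsWalk v (Γ.followList nxt n v) ((Γ.r ∘ nxt)^[n] v) := by
  induction n generalizing v with
  | zero => rfl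
  | succ n ih => exact ⟨hs v hv, ih (hr v hv)⟩

theorem map_source_followList {U : Set V} (hs : ∀ v ∈ U, Γ.s (nxt v) = v)
    (hr : ∀ v ∈ U, Γ.r (nxt v) ∈ U) (n : ℕ) {v : V} (hv : v ∈ U) :
    (Γ.followList nxt n v).map Γ.s = (List.range n).map fun i => (Γ.r ∘ nxt)^[i] v := by
  induction n generalizing v with
  | zero => rfl
  | succ n ih =>
    rw [followList, List.map_cons, ih (hr v hv), List.range_succ_eq_map, hs v hv]
    simp [Function.comp_def]

end follow

namespace CongTriple

theorem existsUnique_edge (t : Γ.CongTriple) {w : V} (hw : w ∈ t.W) :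
    ∃! e : E, Γ.s e = w ∧ Γ.r e ∉ t.H := by
  obtain ⟨e, he⟩ := Set.encard_eq_one.1 (t.index_one w hw)
  have he' : ∀ f, (Γ.s f = w ∧ Γ.r f ∉ t.H) ↔ f = e := fun f => by
    have : f ∈ {e : E | Γ.s e = w ∧ Γ.r e ∉ t.H} ↔ f = e := by rw [he]; rfl
    exact this
  exact ⟨e, (he' e).2 rfl, fun f hf => (he' f).1 hf⟩

theorem exists_next (t : Γ.CongTriple) [Nonempty E] : ∃ nxt : V → E, ∀ w ∈ t.W,
    Γ.s (nxt w) = w ∧ Γ.r (nxt w) ∉ t.H ∧ ∀ e, Γ.s e = w → Γ.r e ∉ t.H → e = nxt w := by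
  have : ∀ w, ∃ e, w ∈ t.W →
      Γ.s e = w ∧ Γ.r e ∉ t.H ∧ ∀ f, Γ.s f = w → Γ.r f ∉ t.H → f = e := by
    intro w
    by_cases hw : w ∈ t.W
    · obtain ⟨e, he, hu⟩ := t.existsUnique_edge hw
      exact ⟨e, fun _ => ⟨he.1, he.2, fun f h1 h2 => hu f ⟨h1, h2⟩⟩⟩
    · exact ⟨Classical.arbitrary E, fun h => absurd h hw⟩
  choose nxt h using this
  exact ⟨nxt, h⟩

/-- A closed walk with all its vertices in `W` is a power of a cycle. -/
theorem exists_cycle_of_closed_walk (t : Γ.CongTriple) {v : V} {p : List E} (hp : Γ.IsWalk v p v)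
    (hne : p ≠ []) (hW : ∀ e ∈ p, Γ.s e ∈ t.W) :
    ∃ c : Γ.Cycle, c.In t.W ∧ c.source = v ∧ ∃ k : ℕ+, Γ.walkElem v p = ppow c.elem k := by
  have : Nonempty E := ⟨p.head hne⟩
  obtain ⟨nxt, hnxt⟩ := t.exists_next
  have hpn : ∀ e ∈ p, e = nxt (Γ.s e) := fun e he => by
    obtain ⟨f, hf, hfe⟩ := hp.exists_source_eq_range he
    exact (hnxt _ (hW e he)).2.2 e rfl (hfe ▸ t.notMem_H (hW f hf))
  obtain ⟨hpl, hvl⟩ := hp.eq_followList hpn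
  -- The vertices of `p` are stable under `nxt`, so everything followed from `v` stays in W.
  set U : Set V := {x | ∃ e ∈ p, Γ.s e = x} with hU
  have hUW : ∀ x ∈ U, x ∈ t.W := by rintro x ⟨e, he, rfl⟩; exact hW e he
  have hs : ∀ x ∈ U, Γ.s (nxt x) = x := fun x hx => (hnxt x (hUW x hx)).1
  have hr : ∀ x ∈ U, Γ.r (nxt x) ∈ U := by
    rintro x ⟨e, he, rfl⟩
    rw [← hpn e he]
    exact hp.exists_source_eq_range he
  have hv : v ∈ U := by
    cases p with
    | nil => exact absurd rfl hne
    | cons e l => exact ⟨e, by simp, hp.1⟩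
  have hper : Function.IsPeriodicPt (Γ.r ∘ nxt) p.length v := hvl.symm
  have hm : 0 < Function.minimalPeriod (Γ.r ∘ nxt) v :=
    hper.minimalPeriod_pos (List.length_pos_iff.2 hne)
  obtain ⟨k, hk⟩ := hper.minimalPeriod_dvd
  set m := Function.minimalPeriod (Γ.r ∘ nxt) v with hmdef
  have hwalk : Γ.IsWalk v (Γ.followList nxt m v) v := by
    have := isWalk_followList hs hr m hv
    rwa [Function.iterate_minimalPeriod] at this
  have hsrc := map_source_followList hs hr m hv
  -- The minimal period is the length of one turn: iterates below it are distinct, hence so are the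
  -- sources.
  have hnodup : ((Γ.followList nxt m v).map Γ.s).Nodup := by
    rw [hsrc]
    refine List.Nodup.map_on ?_ List.nodup_range
    intro i hi j hj hij
    exact Function.iterate_injOn_Iio_minimalPeriod (List.mem_range.1 hi) (List.mem_range.1 hj) hij
  have hpow : ∀ k : ℕ+, Γ.IsWalk v (Γ.followList nxt (m * k) v) v ∧
      Γ.walkElem v (Γ.followList nxt (m * k) v) =
        ppow (Γ.walkElem v (Γ.followList nxt m v)) k := by
    intro k
    induction k using PNat.recOn with
    | one => simpa [ppow_one] using hwalk
    | succ k ih =>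
      have : m * ((k + 1 : ℕ+) : ℕ) = m + m * k := by
        rw [PNat.add_coe, PNat.one_coe]; ring
      rw [this, followList_add, Function.iterate_minimalPeriod]
      refine ⟨isWalk_append.2 ⟨v, hwalk, ih.1⟩, ?_⟩
      rw [walkElem_append hwalk ih.1, ih.2, ppow_succ]
  have hcyc : ∃ c : Γ.Cycle, c.edges = Γ.followList nxt m v ∧ c.source = v := by
    obtain ⟨n, hn⟩ := Nat.exists_eq_succ_of_ne_zero hm.ne'
    rw [hn, followList] at hwalk hnodup ⊢
    have hw : Γ.IsWalk (Γ.s (nxt v)) (nxt v :: Γ.followList nxt n (Γ.r (nxt v))) v :=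
      ⟨rfl, hwalk.2⟩
    obtain ⟨h1, h2⟩ := isWalk_cons_iff.1 hw
    exact ⟨⟨nxt v, _, h1, h2.trans hwalk.1.symm, hnodup⟩, rfl, hwalk.1⟩
  obtain ⟨c, hce, hcs⟩ := hcyc
  have hk0 : 0 < k := by
    rcases Nat.eq_zero_or_pos k with rfl | h
    · exact absurd (List.length_eq_zero_iff.1 (by simpa using hk)) hne
    · exact h
  refine ⟨c, ?_, hcs, ⟨k, hk0⟩, ?_⟩
  · intro e he
    rw [hce] at he
    have : Γ.s e ∈ (Γ.followList nxt m v).map Γ.s := List.mem_map_of_mem he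
    rw [hsrc] at this
    obtain ⟨i, -, hi⟩ := List.mem_map.1 this
    rw [← hi]
    apply hUW
    clear hi
    induction i with
    | zero => exact hv
    | succ i ih => rw [Function.iterate_succ_apply']; exact hr _ ih
  · have := (hpow ⟨k, hk0⟩).2
    rw [PNat.mk_coe, ← hk, ← hpl] at this
    rw [this, c.elem_eq, hce, hcs]

end CongTriple

/-! ### A congruence is determined by its congruence triple -/

theorem leastOrTop_spec {p : ℕ+ → Prop} {m : ℕ+} (h : leastOrTop p = m) : p m := by
  classical
  unfold leastOrTop at h
  split_ifs at h with hp
  swap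
  · exact absurd h.symm WithTop.coe_ne_top
  obtain rfl := WithTop.coe_injective h
  exact PNat.find_spec hp

theorem leastOrTop_of_prop {p : ℕ+ → Prop} {k : ℕ+} (h : p k) :
    ∃ m : ℕ+, leastOrTop p = m ∧ m ≤ k := by
  classical
  have hp : ∃ m, p m := ⟨k, h⟩
  exact ⟨PNat.find hp, by rw [leastOrTop, dif_pos hp], PNat.find_min' hp h⟩

theorem leastOrTop_eq_coe {p : ℕ+ → Prop} {m : ℕ+} (h : p m) (hle : ∀ k, p k → m ≤ k) :
    leastOrTop p = m := by
  obtain ⟨n, hn, hnm⟩ := leastOrTop_of_prop h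
  rw [hn, le_antisymm hnm (hle n (leastOrTop_spec hn))]

theorem leastOrTop_eq_top {p : ℕ+ → Prop} (h : ∀ k, ¬ p k) : leastOrTop p = ⊤ := by
  classical
  rw [leastOrTop, dif_neg (fun ⟨k, hk⟩ => h k hk)]

theorem ppow_add {S : Type*} [Semigroup S] (x : S) (m n : ℕ+) :
    ppow x (m + n) = ppow x m * ppow x n := by
  induction m using PNat.recOn with
  | one => rw [add_comm, ppow_succ, ppow_one]
  | succ m ih => rw [add_right_comm, ppow_succ, ih, ppow_succ, mul_assoc]

theorem con_ppow_mul (σ : Con Γ.InvSemigroup) {x : Γ.InvSemigroup} {v : V} {m : ℕ+}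
    (h : σ (ppow x m) (Γ.vert v)) (k : ℕ+) : σ (ppow x (m * k)) (Γ.vert v) := by
  induction k using PNat.recOn with
  | one => rwa [mul_one]
  | succ k ih =>
    rw [mul_add, mul_one, ppow_add]
    have := σ.mul ih h
    rwa [vert_mul_vert] at this

theorem con_ppow_of_dvd (σ : Con Γ.InvSemigroup) {x : Γ.InvSemigroup} {v : V} {m n : ℕ+}
    (h : σ (ppow x m) (Γ.vert v)) (hmn : m ∣ n) : σ (ppow x n) (Γ.vert v) := by
  obtain ⟨k, rfl⟩ := hmn
  exact con_ppow_mul σ h k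

/-- If `x ^ k` is congruent to the vertex `v`, the least positive exponent with this property
divides `k`. -/
theorem leastOrTop_dvd (ρ : Con Γ.InvSemigroup) {x : Γ.InvSemigroup} {v : V}
    (hx : Γ.vert v * x = x) {k : ℕ+} (h : ρ (ppow x k) (Γ.vert v)) :
    ∃ m : ℕ+, leastOrTop (fun m => ρ (ppow x m) (Γ.vert v)) = m ∧ m ∣ k := by
  obtain ⟨m, hm, -⟩ := leastOrTop_of_prop (p := fun m => ρ (ppow x m) (Γ.vert v)) h
  refine ⟨m, hm, ?_⟩
  have hmρ : ρ (ppow x m) (Γ.vert v) := leastOrTop_spec hm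
  have hmin : ∀ j : ℕ+, ρ (ppow x j) (Γ.vert v) → m ≤ j := fun j hj => by
    obtain ⟨m', hm', hle⟩ := leastOrTop_of_prop (p := fun m => ρ (ppow x m) (Γ.vert v)) hj
    rw [hm] at hm'
    rwa [WithTop.coe_injective hm']
  -- Euclidean descent without cancellation: if k = m + j, then x^k = x^m x^j ρ v x^j = x^j, so j is
  -- again an exponent.
  induction k using PNat.strongInductionOn with
  | _ k ih =>
    rcases (hmin k h).eq_or_lt with rfl | hlt
    · exact dvd_rfl
    · obtain ⟨j, rfl⟩ : ∃ j, k = m + j := ⟨k - m, (PNat.add_sub_of_lt hlt).symm⟩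
      rw [ppow_add] at h
      have h1 : ρ (ppow x m * ppow x j) (Γ.vert v * ppow x j) := ρ.mul hmρ (ρ.refl _)
      rw [ppow_left _ _ hx] at h1
      exact dvd_add dvd_rfl (ih j (PNat.lt_add_left j m) (ρ.trans (ρ.symm h1) h))

theorem Cycle.vert_mul_elem (c : Γ.Cycle) : Γ.vert c.source * c.elem = c.elem := by
  rw [c.elem_eq, vert_mul_walkElem c.isWalk]

theorem conOrder_dvd (ρ : Con Γ.InvSemigroup) (c : Γ.Cycle) {k : ℕ+}
    (h : ρ (ppow c.elem k) (Γ.vert c.source)) : ∃ m : ℕ+, conOrder ρ c = m ∧ m ∣ k :=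
  leastOrTop_dvd ρ c.vert_mul_elem h

theorem Cycle.not_in_conH {ρ : Con Γ.InvSemigroup} {c : Γ.Cycle} (h : c.In (conW ρ)) :
    ¬ c.In (conH ρ) :=
  fun h' => (h c.first List.mem_cons_self).1 (h' c.first List.mem_cons_self)

theorem conF_of_in_conW {ρ : Con Γ.InvSemigroup} {c : Γ.Cycle} (h : c.In (conW ρ)) :
    conF ρ c = conOrder ρ c := by
  rw [conF, if_neg (Cycle.not_in_conH h), if_pos h]

theorem toCon_toTriple_le (ρ : Con Γ.InvSemigroup) : (Γ.toTriple ρ).toCon ≤ ρ := by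
  refine Con.conGen_le.2 ?_
  intro x y h
  cases h with
  | vert_zero v hv => exact hv
  | edge_star e hs hr =>
    obtain ⟨_, f, hf, hfr, hρ⟩ := hs
    obtain ⟨g, -, hg⟩ := (Γ.toTriple ρ).existsUnique_edge (w := Γ.s e)
      ⟨‹_›, f, hf, hfr, hρ⟩
    obtain rfl : f = e := (hg f ⟨hf, hfr⟩).trans (hg e ⟨rfl, hr⟩).symm
    exact hρ
  | cycle_pow c hc m hm =>
    exact leastOrTop_spec ((conF_of_in_conW hc).symm.trans hm)

/-! ### The inclusion of ρ in the congruence generated by its triple. -/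

section

variable {ρ : Con Γ.InvSemigroup}

theorem con_mul_zero {x : Γ.InvSemigroup} (y : Γ.InvSemigroup) (h : ρ x 0) : ρ (x * y) 0 := by
  have := ρ.mul h (ρ.refl y)
  rwa [zero_mul] at this

theorem con_zero_mul {x : Γ.InvSemigroup} (y : Γ.InvSemigroup) (h : ρ x 0) : ρ (y * x) 0 := by
  have := ρ.mul (ρ.refl y) h
  rwa [mul_zero] at this

/-- If r(e) were in H, then ee* = e r(e) e* would be congruent to 0, and s(e) with it. So the pair
is itself a generator. -/
theorem toCon_toTriple_edge {e : E} (hs : Γ.s e ∉ conH ρ)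
    (h : ρ (Γ.edge e * Γ.star e) (Γ.vert (Γ.s e))) :
    (Γ.toTriple ρ).toCon (Γ.edge e * Γ.star e) (Γ.vert (Γ.s e)) ∧ Γ.s e ∈ conW ρ := by
  have hr : Γ.r e ∉ conH ρ := fun hr => hs <| by
    have h1 : ρ (Γ.edge e * Γ.vert (Γ.r e) * Γ.star e) 0 := con_mul_zero _ (con_zero_mul _ hr)
    rw [edge_mul_vert] at h1
    exact ρ.trans (ρ.symm h) h1
  have hW : Γ.s e ∈ conW ρ := ⟨hs, e, rfl, hr, h⟩
  exact ⟨ConGen.Rel.of _ _ (.edge_star e hW hr), hW⟩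

/-- Left multiplication by ee* fixes any product starting with e, whereas it sends s(e) to ee*. -/
theorem con_edge_star_of_con_mul {v w : V} {e : E} {l : List E} {y : Γ.InvSemigroup}
    (hl : Γ.IsWalk v (e :: l) w) (h : ρ (Γ.vert v) (Γ.walkElem v (e :: l) * y)) :
    ρ (Γ.edge e * Γ.star e) (Γ.vert (Γ.s e)) := by
  obtain ⟨rfl, hl⟩ := hl
  have h1 := ρ.mul (ρ.refl (Γ.edge e * Γ.star e)) h
  have h2 : Γ.edge e * Γ.star e * (Γ.walkElem (Γ.s e) (e :: l) * y) =
      Γ.walkElem (Γ.s e) (e :: l) * y := by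
    rw [walkElem, ← mul_assoc, ← mul_assoc, mul_assoc _ (Γ.star e), star_mul_edge,
      edge_mul_vert]
  rw [h2, mul_assoc, star_mul_vert] at h1
  exact ρ.trans h1 (ρ.symm h)

theorem con_closed_walk_rotate {v w : V} {a b : List E} (ha : Γ.IsWalk v a w)
    (hb : Γ.IsWalk w b v) (h : ρ (Γ.vert v) (Γ.walkElem v (a ++ b))) :
    ρ (Γ.vert w) (Γ.walkElem w (b ++ a)) := by
  have h1 := ρ.mul (ρ.mul (ρ.refl (Γ.walkStar v a)) h) (ρ.refl (Γ.walkElem v a))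
  rwa [walkStar_mul_vert ha, walkStar_mul_walkElem ha, walkElem_append ha hb,
    ← mul_assoc (Γ.walkStar v a), walkStar_mul_walkElem ha, vert_mul_walkElem hb,
    ← walkElem_append hb ha] at h1

/-- Rotating the closed walk makes it start at `e`, where `con_edge_star_of_con_mul` applies. No
vertex on it is in H, or the whole walk would be congruent to 0. -/
theorem con_closed_walk_edge {v : V} {p : List E} (hp : Γ.IsWalk v p v) (hv : v ∉ conH ρ)
    (h : ρ (Γ.vert v) (Γ.walkElem v p)) {e : E} (he : e ∈ p) :
    (Γ.toTriple ρ).toCon (Γ.edge e * Γ.star e) (Γ.vert (Γ.s e)) ∧ Γ.s e ∈ conW ρ := by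
  obtain ⟨a, b, rfl⟩ := List.append_of_mem he
  obtain ⟨w, ha, hb⟩ := isWalk_append.1 hp
  obtain rfl : Γ.s e = w := hb.1
  have hw : Γ.s e ∉ conH ρ := fun hw => hv <| by
    refine ρ.trans h ?_
    rw [walkElem_append ha hb, ← vert_mul_walkElem hb]
    exact con_zero_mul _ (con_mul_zero _ hw)
  refine toCon_toTriple_edge hw ?_
  have h1 := con_closed_walk_rotate ha hb h
  have hba : Γ.IsWalk (Γ.s e) (e :: (b ++ a)) (Γ.s e) := isWalk_append.2 ⟨v, hb, ha⟩
  refine con_edge_star_of_con_mul hba (y := Γ.vert (Γ.s e)) ?_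
  rw [walkElem_mul_vert hba]
  exact h1

/-- The product pp* collapses from its innermost edge outwards. -/
theorem con_walk_mul_star (σ : Con Γ.InvSemigroup) {v w : V} {l : List E} (hl : Γ.IsWalk v l w)
    (h : ∀ e ∈ l, σ (Γ.edge e * Γ.star e) (Γ.vert (Γ.s e))) :
    σ (Γ.walkElem v l * Γ.walkStar v l) (Γ.vert v) := by
  induction l generalizing v with
  | nil => rw [walkElem, walkStar, vert_mul_vert]; exact σ.refl _
  | cons e l ih =>
    obtain ⟨rfl, hl⟩ := hl
    have h1 := σ.mul (σ.mul (σ.refl (Γ.edge e))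
      (ih hl (fun f hf => h f (List.mem_cons_of_mem _ hf)))) (σ.refl (Γ.star e))
    rw [edge_mul_vert] at h1
    have h2 := σ.trans h1 (h e List.mem_cons_self)
    simpa [walkElem, walkStar, mul_assoc] using h2

theorem toCon_toTriple_closed_walk {v : V} {p : List E} (hp : Γ.IsWalk v p v) (hv : v ∉ conH ρ)
    (h : ρ (Γ.vert v) (Γ.walkElem v p)) :
    (Γ.toTriple ρ).toCon (Γ.vert v) (Γ.walkElem v p) := by
  by_cases hne : p = []
  · subst hne; exact Con.refl _ _
  obtain ⟨c, hc, rfl, k, hk⟩ := (Γ.toTriple ρ).exists_cycle_of_closed_walk hp hne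
    (fun e he => (con_closed_walk_edge hp hv h he).2)
  rw [hk] at h ⊢
  obtain ⟨m, hm, hmk⟩ := conOrder_dvd ρ c (ρ.symm h)
  refine Con.symm _ (con_ppow_of_dvd _ (ConGen.Rel.of _ _ (.cycle_pow c hc m ?_)) hmk)
  exact (conF_of_in_conW hc).trans hm

/-- Induction on `a`, stripping a common first edge by conjugation. If one walk is empty, the other
is closed and congruent to its base vertex. -/
theorem toCon_toTriple_vert {v w : V} {a b : List E} (ha : Γ.IsWalk v a w) (hb : Γ.IsWalk v b w)
    (hv : v ∉ conH ρ) (h : ρ (Γ.vert v) (Γ.walkElem v a * Γ.walkStar v b)) :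
    (Γ.toTriple ρ).toCon (Γ.vert v) (Γ.walkElem v a * Γ.walkStar v b) := by
  induction a generalizing v b with
  | nil =>
    obtain rfl := ha
    simp only [walkElem] at h ⊢
    rw [vert_mul_walkStar hb] at h ⊢
    have h1 := ρ.mul h (ρ.refl (Γ.walkElem v b))
    rw [walkStar_mul_walkElem hb, vert_mul_walkElem hb] at h1
    have h2 := toCon_toTriple_closed_walk hb hv (ρ.symm h1)
    have h3 := Con.mul _ (Con.refl _ (Γ.walkStar v b)) h2
    rw [walkStar_mul_vert hb, walkStar_mul_walkElem hb] at h3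
    exact Con.symm _ h3
  | cons e a ih =>
    cases b with
    | nil =>
      obtain rfl := hb
      simp only [walkStar] at h ⊢
      rw [walkElem_mul_vert ha] at h ⊢
      exact toCon_toTriple_closed_walk ha hv h
    | cons f b =>
      obtain ⟨rfl, ha'⟩ := ha
      have he := con_edge_star_of_con_mul (hl := (⟨rfl, ha'⟩ : Γ.IsWalk (Γ.s e) (e :: a) w)) h
      obtain ⟨hσ, hW⟩ := toCon_toTriple_edge hv he
      have hre : Γ.vert (Γ.r e) = Γ.star e * Γ.vert (Γ.s e) * Γ.edge e := by
        rw [star_mul_vert, star_mul_edge]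
      by_cases hef : e = f
      · subst hef
        have hr : Γ.r e ∉ conH ρ := fun hr => hv <| by
          have h1 : ρ (Γ.edge e * Γ.vert (Γ.r e) * Γ.star e) 0 :=
            con_mul_zero _ (con_zero_mul _ hr)
          rw [edge_mul_vert] at h1
          exact ρ.trans (ρ.symm he) h1
        have h1 := ρ.mul (ρ.mul (ρ.refl (Γ.star e)) h) (ρ.refl (Γ.edge e))
        have h2 : Γ.star e * (Γ.walkElem (Γ.s e) (e :: a) * Γ.walkStar (Γ.s e) (e :: b)) *
            Γ.edge e = Γ.walkElem (Γ.r e) a * Γ.walkStar (Γ.r e) b := by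
          simp only [walkElem, walkStar, mul_assoc]
          rw [star_mul_edge, ← mul_assoc (Γ.star e), star_mul_edge, ← mul_assoc,
            vert_mul_walkElem ha', walkStar_mul_vert hb.2]
        rw [← hre, h2] at h1
        have h3 := Con.mul _ (Con.mul _ (Con.refl _ (Γ.edge e)) (ih ha' hb.2 hr h1))
          (Con.refl _ (Γ.star e))
        rw [edge_mul_vert] at h3
        have h4 := Con.trans _ (Con.symm _ hσ) h3
        simpa only [walkElem, walkStar, mul_assoc] using h4
      · exfalso
        apply hv
        -- Different first edges meet as f*e = 0, so ee* and hence s(e) would be congruent to 0.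
        have h2 : Γ.walkElem (Γ.s e) (e :: a) * Γ.walkStar (Γ.s e) (f :: b) *
            (Γ.edge e * Γ.star e) = 0 := by
          simp only [walkElem, walkStar, mul_assoc]
          rw [← mul_assoc (Γ.star f), star_mul_edge_ne (Ne.symm hef)]
          simp
        have h3 := ρ.mul h (ρ.refl (Γ.edge e * Γ.star e))
        rw [h2, ← mul_assoc, vert_mul_edge] at h3
        exact ρ.trans (ρ.symm he) h3

theorem le_toCon_toTriple (ρ : Con Γ.InvSemigroup) : ρ ≤ (Γ.toTriple ρ).toCon := by
  have hzero : ∀ {u v w : V} {a b : List E}, Γ.IsWalk u a w → Γ.IsWalk v b w →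
      w ∈ conH ρ → (Γ.toTriple ρ).toCon (Γ.walkElem u a * Γ.walkStar v b) 0 := by
    intro u v w a b ha hb hw
    have : (Γ.toTriple ρ).toCon (Γ.vert w) 0 := ConGen.Rel.of _ _ (.vert_zero w hw)
    rw [← walkElem_mul_vert ha]
    exact con_mul_zero _ (con_zero_mul _ this)
  have hconj : ∀ {u v w : V} {a b : List E}, Γ.IsWalk u a w → Γ.IsWalk v b w →
      Γ.walkStar u a * (Γ.walkElem u a * Γ.walkStar v b) * Γ.walkElem v b = Γ.vert w := by
    intro u v w a b ha hb
    rw [← mul_assoc, walkStar_mul_walkElem ha, vert_mul_walkStar hb, walkStar_mul_walkElem hb]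
  have hz : ∀ {x : Γ.InvSemigroup}, ρ x 0 → (Γ.toTriple ρ).toCon x 0 := by
    intro x h
    rcases isNormal x with rfl | ⟨u, v, w, a, b, ha, hb, rfl⟩
    · exact Con.refl _ _
    · refine hzero ha hb ?_
      have := con_mul_zero (Γ.walkElem v b) (con_zero_mul (Γ.walkStar u a) h)
      rwa [hconj ha hb] at this
  -- the case where the left factor of `x` is a prefix of the left factor of `y`
  have main : ∀ {u v w w' : V} {a b t d : List E}, Γ.IsWalk u a w → Γ.IsWalk v b w →
      Γ.IsWalk u (a ++ t) w' → Γ.IsWalk v d w' → w ∉ conH ρ →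
      ((∃ s, d = b ++ s) ∨ ∃ s, b = d ++ s) →
      ρ (Γ.walkElem u a * Γ.walkStar v b) (Γ.walkElem u (a ++ t) * Γ.walkStar v d) →
      (Γ.toTriple ρ).toCon (Γ.walkElem u a * Γ.walkStar v b)
        (Γ.walkElem u (a ++ t) * Γ.walkStar v d) := by
    intro u v w w' a b t d ha hb hat hd hw hbd h
    have ht := ha.of_append hat
    have h1 := ρ.mul (ρ.mul (ρ.refl (Γ.walkStar u a)) h) (ρ.refl (Γ.walkElem v b))
    rw [hconj ha hb, walkElem_append ha ht, mul_assoc (Γ.walkElem u a), ← mul_assoc,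
      walkStar_mul_walkElem ha, ← mul_assoc, vert_mul_walkElem ht] at h1
    -- When d = bs, `h1` relates w to ts*; when b = ds, it relates w to the closed walk ts.
    rcases hbd with ⟨s, rfl⟩ | ⟨s, rfl⟩
    · have hs := hb.of_append hd
      rw [walkStar_append hb hs, mul_assoc, mul_assoc, walkStar_mul_walkElem hb,
        walkStar_mul_vert hs] at h1
      have h2 := toCon_toTriple_vert ht hs hw h1
      have h3 := Con.mul _ (Con.mul _ (Con.refl _ (Γ.walkElem u a)) h2)
        (Con.refl _ (Γ.walkStar v b))
      rw [walkElem_mul_vert ha] at h3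
      rw [walkElem_append ha ht, walkStar_append hb hs]
      simpa only [mul_assoc] using h3
    · have hs := hd.of_append hb
      rw [walkElem_append hd hs, mul_assoc, ← mul_assoc (Γ.walkStar v d),
        walkStar_mul_walkElem hd, vert_mul_walkElem hs, ← walkElem_append ht hs] at h1
      have hts : Γ.IsWalk w (t ++ s) w := isWalk_append.2 ⟨_, ht, hs⟩
      have h2 := toCon_toTriple_closed_walk hts hw h1
      have h3 := con_walk_mul_star (Γ.toTriple ρ).toCon hs
        (fun e he => (con_closed_walk_edge hts hw h1 (List.mem_append_right _ he)).1)
      -- the inverse of `s` is congruent to `t`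
      have h4 : (Γ.toTriple ρ).toCon (Γ.walkStar w' s) (Γ.walkElem w t) := by
        have h5 := Con.mul _ h2 (Con.refl _ (Γ.walkStar w' s))
        have h6 := Con.mul _ (Con.refl _ (Γ.walkElem w t)) h3
        rw [vert_mul_walkStar hs, walkElem_append ht hs, mul_assoc] at h5
        rw [walkElem_mul_vert ht] at h6
        exact Con.trans _ h5 h6
      rw [walkElem_append ha ht, walkStar_append hd hs, ← mul_assoc]
      exact Con.mul _ (Con.mul _ (Con.refl _ _) h4) (Con.refl _ _)
  intro x y h
  by_cases hx0 : ρ x 0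
  · exact Con.trans _ (hz hx0) (Con.symm _ (hz (ρ.trans (ρ.symm h) hx0)))
  have hy0 : ¬ ρ y 0 := fun hy => hx0 (ρ.trans h hy)
  rcases isNormal x with rfl | ⟨u, v, w, a, b, ha, hb, rfl⟩
  · exact absurd (ρ.refl _) hx0
  rcases isNormal y with rfl | ⟨u', v', w', c, d, hc, hd, rfl⟩
  · exact absurd (ρ.refl _) hy0
  have hw : w ∉ conH ρ := fun hw => hx0 (toCon_toTriple_le ρ (hzero ha hb hw))
  have hw' : w' ∉ conH ρ := fun hw => hy0 (toCon_toTriple_le ρ (hzero hc hd hw))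
  have h1 := ρ.mul (ρ.mul (ρ.refl (Γ.walkStar u a)) h) (ρ.refl (Γ.walkElem v b))
  rw [hconj ha hb, ← mul_assoc, mul_assoc] at h1
  rcases walkStar_mul_walkElem_eq_zero_or ha hc with h0 | ⟨rfl, hac⟩
  · rw [h0, zero_mul] at h1
    exact absurd h1 hw
  rcases walkStar_mul_walkElem_eq_zero_or hd hb with h0 | ⟨rfl, hdb⟩
  · rw [h0, mul_zero] at h1
    exact absurd h1 hw
  rcases hac with ⟨t, rfl⟩ | ⟨t, rfl⟩
  · exact main ha hb hc hd hw hdb.symm h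
  · exact Con.symm _ (main hc hd ha hb hw' hdb (ρ.symm h))

end

theorem toCon_toTriple (ρ : Con Γ.InvSemigroup) : (Γ.toTriple ρ).toCon = ρ :=
  le_antisymm (toCon_toTriple_le ρ) (le_toCon_toTriple ρ)

/-! ### Actions by binary relations -/

/-- Binary relations on `X`, composed from right to left. -/
def RelEnd (X : Type*) : Type _ := X → X → Prop

namespace RelEnd

variable {X : Type*}

/-- The right factor acts first, giving a left action in which an edge prepends itself. Relations
need no domain or injectivity conditions when composed. -/
instance : Mul (RelEnd X) := ⟨fun a b x z => ∃ y, b x y ∧ a y z⟩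

instance : Zero (RelEnd X) := ⟨fun _ _ => False⟩

theorem mul_apply (a b : RelEnd X) (x z : X) : (a * b) x z ↔ ∃ y, b x y ∧ a y z := Iff.rfl

theorem zero_apply (x y : X) : (0 : RelEnd X) x y ↔ False := Iff.rfl

theorem ext {a b : RelEnd X} (h : ∀ x y, a x y ↔ b x y) : a = b :=
  funext fun x => funext fun y => propext (h x y)

instance : SemigroupWithZero (RelEnd X) where
  mul_assoc a b c := ext fun x y => by
    simp only [mul_apply]
    constructor
    · rintro ⟨z, h1, w, h2, h3⟩; exact ⟨w, ⟨z, h1, h2⟩, h3⟩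
    · rintro ⟨w, ⟨z, h1, h2⟩, h3⟩; exact ⟨z, h1, w, h2, h3⟩
  zero_mul a := ext fun x y => by simp [mul_apply, zero_apply]
  mul_zero a := ext fun x y => by simp [mul_apply, zero_apply]

end RelEnd

/-- The universal property of the graph inverse semigroup. -/
theorem exists_mulHom {M : Type*} [SemigroupWithZero M] (g : Gen V E → M)
    (vv : ∀ v, g (.vertex v) * g (.vertex v) = g (.vertex v))
    (vw : ∀ v w, v ≠ w → g (.vertex v) * g (.vertex w) = 0)
    (se : ∀ e, g (.vertex (Γ.s e)) * g (.edge e) = g (.edge e))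
    (er : ∀ e, g (.edge e) * g (.vertex (Γ.r e)) = g (.edge e))
    (rs : ∀ e, g (.vertex (Γ.r e)) * g (.star e) = g (.star e))
    (ss : ∀ e, g (.star e) * g (.vertex (Γ.s e)) = g (.star e))
    (st : ∀ e, g (.star e) * g (.edge e) = g (.vertex (Γ.r e)))
    (sn : ∀ f e, f ≠ e → g (.star f) * g (.edge e) = 0) :
    ∃ F : Γ.InvSemigroup →ₙ* M, F 0 = 0 ∧ (∀ v, F (Γ.vert v) = g (.vertex v)) ∧
      (∀ e, F (Γ.edge e) = g (.edge e)) ∧ ∀ e, F (Γ.star e) = g (.star e) := by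
  let F₀ : FreeZero V E → M := fun x => WithZero.recZeroCoe 0 (FreeSemigroup.lift g) x
  have hmul : ∀ x y, F₀ (x * y) = F₀ x * F₀ y := by
    intro x y
    induction x using WithZero.recZeroCoe with
    | zero => rw [zero_mul]; exact (zero_mul _).symm
    | coe x =>
      induction y using WithZero.recZeroCoe with
      | zero => rw [mul_zero]; exact (mul_zero _).symm
      | coe y => exact map_mul (FreeSemigroup.lift g) x y
  let F₁ : FreeZero V E →ₙ* M := ⟨F₀, hmul⟩
  have hof : ∀ x, F₁ (FreeZero.of x) = g x := fun x => FreeSemigroup.lift_of g x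
  have hker : conGen Γ.DefRel ≤ Con.ker F₁ := by
    refine Con.conGen_le.2 ?_
    intro x y h
    rw [Con.ker_rel]
    cases h with
    | vertex_mul_self v => simp only [map_mul, hof, vv]
    | vertex_mul_ne v w h => simp only [map_mul, hof, vw v w h]; rfl
    | source_mul_edge e => simp only [map_mul, hof, se]
    | edge_mul_range e => simp only [map_mul, hof, er]
    | range_mul_star e => simp only [map_mul, hof, rs]
    | star_mul_source e => simp only [map_mul, hof, ss]
    | star_mul_self e => simp only [map_mul, hof, st]
    | star_mul_ne f e h => simp only [map_mul, hof, sn f e h]; rfl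
  refine ⟨⟨fun x => Con.liftOn x F₁ fun _ _ h => hker h, fun x y => ?_⟩, rfl,
    fun v => hof _, fun e => hof _, fun e => hof _⟩
  induction x using Con.induction_on with
  | H x =>
    induction y using Con.induction_on with
    | H y => exact hmul x y

/-- The action of the graph inverse semigroup on a branching system. -/
theorem exists_action {X : Type*} (D : V → Set X) (ι : E → X → X)
    (hD : ∀ x u v, x ∈ D u → x ∈ D v → u = v) (hinj : ∀ e, Function.Injective (ι e))
    (hι : ∀ e x, x ∈ D (Γ.r e) → ι e x ∈ D (Γ.s e)) (hne : ∀ e f x y, ι e x = ι f y → e = f) :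
    ∃ F : Γ.InvSemigroup →ₙ* RelEnd X, F 0 = 0 ∧
      (∀ v x y, F (Γ.vert v) x y ↔ x ∈ D v ∧ y = x) ∧
      (∀ e x y, F (Γ.edge e) x y ↔ x ∈ D (Γ.r e) ∧ y = ι e x) ∧
      (∀ e x y, F (Γ.star e) x y ↔ y ∈ D (Γ.r e) ∧ x = ι e y) := by
  let g : Gen V E → RelEnd X
    | .vertex v => fun x y => x ∈ D v ∧ y = x
    | .edge e => fun x y => x ∈ D (Γ.r e) ∧ y = ι e x
    | .star e => fun x y => y ∈ D (Γ.r e) ∧ x = ι e y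
  have gv : ∀ v x y, g (.vertex v) x y ↔ x ∈ D v ∧ y = x := fun _ _ _ => Iff.rfl
  have ge : ∀ e x y, g (.edge e) x y ↔ x ∈ D (Γ.r e) ∧ y = ι e x := fun _ _ _ => Iff.rfl
  have gs : ∀ e x y, g (.star e) x y ↔ y ∈ D (Γ.r e) ∧ x = ι e y := fun _ _ _ => Iff.rfl
  obtain ⟨F, h0, hv, he, hs⟩ := exists_mulHom (Γ := Γ) g
    (fun v => RelEnd.ext fun x y => by
      simp only [RelEnd.mul_apply, gv]
      constructor
      · rintro ⟨_, ⟨h, rfl⟩, -, rfl⟩; exact ⟨h, rfl⟩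
      · rintro ⟨h, rfl⟩; exact ⟨_, ⟨h, rfl⟩, h, rfl⟩)
    (fun v w h => RelEnd.ext fun x y => by
      simp only [RelEnd.mul_apply, gv, RelEnd.zero_apply, iff_false]
      rintro ⟨_, ⟨h1, rfl⟩, h2, rfl⟩
      exact h (hD _ _ _ h2 h1))
    (fun e => RelEnd.ext fun x y => by
      simp only [RelEnd.mul_apply, gv, ge]
      constructor
      · rintro ⟨_, ⟨h, rfl⟩, -, rfl⟩; exact ⟨h, rfl⟩
      · rintro ⟨h, rfl⟩; exact ⟨_, ⟨h, rfl⟩, hι e x h, rfl⟩)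
    (fun e => RelEnd.ext fun x y => by
      simp only [RelEnd.mul_apply, gv, ge]
      constructor
      · rintro ⟨_, ⟨h, rfl⟩, -, rfl⟩; exact ⟨h, rfl⟩
      · rintro ⟨h, rfl⟩; exact ⟨_, ⟨h, rfl⟩, h, rfl⟩)
    (fun e => RelEnd.ext fun x y => by
      simp only [RelEnd.mul_apply, gv, gs]
      constructor
      · rintro ⟨_, ⟨h, rfl⟩, -, rfl⟩; exact ⟨h, rfl⟩
      · rintro ⟨h, rfl⟩; exact ⟨_, ⟨h, rfl⟩, h, rfl⟩)
    (fun e => RelEnd.ext fun x y => by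
      simp only [RelEnd.mul_apply, gv, gs]
      constructor
      · rintro ⟨_, ⟨-, rfl⟩, h, rfl⟩; exact ⟨h, rfl⟩
      · rintro ⟨h, rfl⟩; exact ⟨_, ⟨hι e y h, rfl⟩, h, rfl⟩)
    (fun e => RelEnd.ext fun x y => by
      simp only [RelEnd.mul_apply, gv, gs, ge]
      constructor
      · rintro ⟨_, ⟨h, rfl⟩, -, h'⟩; exact ⟨h, (hinj e h').symm⟩
      · rintro ⟨h, rfl⟩; exact ⟨_, ⟨h, rfl⟩, h, rfl⟩)
    (fun f e h => RelEnd.ext fun x y => by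
      simp only [RelEnd.mul_apply, gs, ge, RelEnd.zero_apply, iff_false]
      rintro ⟨_, ⟨-, rfl⟩, -, h'⟩
      exact h (hne _ _ _ _ h').symm)
  refine ⟨F, h0, ?_, ?_, ?_⟩
  · intro v x y; rw [hv]
  · intro e x y; rw [he]
  · intro e x y; rw [hs]

/-! ### Boundary paths -/

variable (Γ) in
/-- The source of an edge, or the vertex itself. -/
def letterSource : E ⊕ V → V := Sum.elim Γ.s id

namespace CongTriple

/-- The local condition on two consecutive letters of a boundary path. -/
def Admissible (t : Γ.CongTriple) : E ⊕ V → E ⊕ V → Prop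
  | .inl e, b => Γ.r e ∉ t.H ∧ Γ.letterSource b = Γ.r e
  | .inr v, _ => v ∉ t.H ∧ v ∉ t.W

/-- The boundary paths starting at `v`: infinite paths outside `H`, and finite paths outside `H`
ending at a vertex outside `W`, which is repeated after the last edge. -/
def boundary (t : Γ.CongTriple) (v : V) : Set (Stream' (E ⊕ V)) :=
  {x | Γ.letterSource x.head = v ∧ ∀ k, t.Admissible (x.get k) (x.get (k + 1))}

variable {t : Γ.CongTriple}

/-- Nothing links a terminal vertex letter to the letter after it, so the first alternative says
nothing about the tail. -/
theorem boundary_cases {v : V} {x : Stream' (E ⊕ V)} (hx : x ∈ t.boundary v) :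
    (x.head = .inr v ∧ v ∉ t.H ∧ v ∉ t.W) ∨
      ∃ e, x.head = .inl e ∧ Γ.s e = v ∧ Γ.r e ∉ t.H ∧ x.tail ∈ t.boundary (Γ.r e) := by
  obtain ⟨h1, h2⟩ := hx
  have h0 := h2 0
  change t.Admissible x.head x.tail.head at h0
  rcases hh : x.head with e | w
  · rw [hh] at h0 h1
    exact Or.inr ⟨e, rfl, h1, h0.1, h0.2, fun k => h2 (k + 1)⟩
  · rw [hh] at h0 h1
    obtain rfl : w = v := h1
    exact Or.inl ⟨rfl, h0⟩

theorem notMem_H_of_mem_boundary {v : V} {x : Stream' (E ⊕ V)} (hx : x ∈ t.boundary v) :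
    v ∉ t.H := by
  rcases boundary_cases hx with ⟨-, h, -⟩ | ⟨e, -, rfl, he, -⟩
  · exact h
  · exact fun h => he (t.hereditary e h)

theorem cons_mem_boundary {e : E} {x : Stream' (E ⊕ V)} (hx : x ∈ t.boundary (Γ.r e)) :
    Stream'.cons (.inl e) x ∈ t.boundary (Γ.s e) := by
  refine ⟨rfl, fun k => ?_⟩
  cases k with
  | zero => exact ⟨notMem_H_of_mem_boundary hx, hx.1⟩
  | succ k => exact hx.2 k

/-- From a vertex of W follow its unique edge avoiding H; at any other vertex stop, repeating the
vertex letter. This never enters H. -/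
theorem exists_mem_boundary (t : Γ.CongTriple) {v : V} (hv : v ∉ t.H) :
    ∃ x ∈ t.boundary v, v ∉ t.W → x.head = .inr v := by
  have : ∀ w, ∃ b : E ⊕ V, Γ.letterSource b = w ∧
      (w ∉ t.H → Sum.elim Γ.r id b ∉ t.H ∧ (w ∉ t.W → b = .inr w) ∧
        ∀ b', Γ.letterSource b' = Sum.elim Γ.r id b → t.Admissible b b') := by
    intro w
    by_cases hw : w ∈ t.W
    · obtain ⟨e, ⟨h1, h2⟩, -⟩ := t.existsUnique_edge hw
      exact ⟨.inl e, h1, fun _ => ⟨h2, fun h => absurd hw h, fun b' hb' => ⟨h2, hb'⟩⟩⟩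
    · exact ⟨.inr w, rfl, fun h => ⟨h, fun _ => rfl, fun _ _ => ⟨h, hw⟩⟩⟩
  choose out hs hout using this
  have hH : ∀ k : ℕ, (fun w => Sum.elim Γ.r id (out w))^[k] v ∉ t.H := by
    intro k
    induction k with
    | zero => exact hv
    | succ k ih => rw [Function.iterate_succ_apply']; exact (hout _ ih).1
  refine ⟨fun k => out ((fun w => Sum.elim Γ.r id (out w))^[k] v), ⟨hs v, fun k => ?_⟩,
    fun hW => (hout v hv).2.1 hW⟩
  refine (hout _ (hH k)).2.2 _ ?_
  change Γ.letterSource (out _) = _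
  rw [hs, Function.iterate_succ_apply']

/-- A path inside `U` can never stop, and its next edge is always forced. -/
theorem boundary_subsingleton {U : Set V} (hUW : U ⊆ t.W)
    (hU : ∀ e, Γ.s e ∈ U → Γ.r e ∉ t.H → Γ.r e ∈ U) {v : V} (hv : v ∈ U) :
    (t.boundary v).Subsingleton := by
  intro x hx y hy
  refine Stream'.ext fun n => ?_
  induction n generalizing v x y with
  | zero =>
    change x.head = y.head
    rcases boundary_cases hx with ⟨-, -, h⟩ | ⟨e, he, hev, her, -⟩
    · exact absurd (hUW hv) h
    rcases boundary_cases hy with ⟨-, -, h⟩ | ⟨f, hf, hfv, hfr, -⟩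
    · exact absurd (hUW hv) h
    rw [he, hf, (t.existsUnique_edge (hUW hv)).unique ⟨hev, her⟩ ⟨hfv, hfr⟩]
  | succ n ih =>
    rcases boundary_cases hx with ⟨-, -, h⟩ | ⟨e, he, rfl, her, hx'⟩
    · exact absurd (hUW hv) h
    rcases boundary_cases hy with ⟨-, -, h⟩ | ⟨f, hf, hfv, hfr, hy'⟩
    · exact absurd (hUW hv) h
    obtain rfl := (t.existsUnique_edge (hUW hv)).unique ⟨rfl, her⟩ ⟨hfv, hfr⟩
    exact ih (hU e hv her) hx' hy'

theorem boundary_cycle_subsingleton {c : Γ.Cycle} (hc : c.In t.W) :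
    (t.boundary c.source).Subsingleton := by
  refine boundary_subsingleton (U := {v | ∃ e ∈ c.edges, Γ.s e = v}) ?_ ?_
    ⟨c.first, List.mem_cons_self, rfl⟩
  · rintro _ ⟨e, he, rfl⟩; exact hc e he
  · rintro f ⟨e, he, hef⟩ hf
    obtain ⟨g, hg, hgr⟩ := c.isWalk.exists_source_eq_range he
    obtain rfl := (t.existsUnique_edge (hc e he)).unique ⟨rfl, hgr ▸ t.notMem_H (hc g hg)⟩
      ⟨hef.symm, hf⟩
    exact ⟨g, hg, hgr⟩

/-- The action of the graph inverse semigroup on boundary paths, twisted by a weight of the edges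
with values in an abelian group, factors through the congruence of a triple as soon as the
cycle relations hold for the weights. -/
theorem exists_weighted_action (t : Γ.CongTriple) {G : Type*} [AddCommGroup G] (wt : E → G)
    (hwt : ∀ (d : Γ.Cycle) (m : ℕ+), d.In t.W → t.f d = m →
      (m : ℕ) • (d.edges.map wt).sum = 0) :
    ∃ F : Γ.InvSemigroup →ₙ* RelEnd (Stream' (E ⊕ V) × G), F 0 = 0 ∧ t.toCon ≤ Con.ker F ∧
      (∀ v x y, F (Γ.vert v) x y ↔ x.1 ∈ t.boundary v ∧ y = x) ∧
      (∀ e x y, F (Γ.edge e * Γ.star e) x y → ∃ z, x.1 = Stream'.cons (.inl e) z) ∧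
      ∀ c : Γ.Cycle, c.In t.W → ∀ (m : ℕ+) x y, F (ppow c.elem m) x y ↔
        x.1 ∈ t.boundary c.source ∧ y = (x.1, x.2 + (m : ℕ) • (c.edges.map wt).sum) := by
  obtain ⟨F, h0, hv, he, hs⟩ := exists_action (Γ := Γ)
    (D := fun v => {x : Stream' (E ⊕ V) × G | x.1 ∈ t.boundary v})
    (ι := fun e x => (Stream'.cons (.inl e) x.1, x.2 + wt e))
    (fun x u v hu hv => hu.1.symm.trans hv.1)
    (fun e x y h => by
      obtain ⟨h1, h2⟩ := Prod.mk.inj h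
      exact Prod.ext (Stream'.cons_injective_right _ h1) (add_right_cancel h2))
    (fun e x hx => cons_mem_boundary hx)
    (fun e f x y h => Sum.inl_injective (Stream'.cons_injective2 (Prod.mk.inj h).1).1)
  have hes : ∀ e x y, F (Γ.edge e * Γ.star e) x y ↔
      (∃ z ∈ t.boundary (Γ.r e), x.1 = Stream'.cons (.inl e) z) ∧ y = x := by
    intro e x y
    rw [map_mul, RelEnd.mul_apply]
    constructor
    · rintro ⟨z, h1, h2⟩
      rw [hs] at h1
      rw [he] at h2
      obtain ⟨h1, rfl⟩ := h1
      exact ⟨⟨_, h1, rfl⟩, h2.2⟩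
    · rintro ⟨⟨z, hz, hx⟩, rfl⟩
      -- The intermediate point has `e` removed and its weight taken back, so ee* is the identity on
      -- paths starting with `e`.
      refine ⟨(z, y.2 - wt e), (hs _ _ _).2 ⟨hz, ?_⟩, (he _ _ _).2 ⟨hz, ?_⟩⟩ <;>
      exact Prod.ext hx (by simp)
  have hwalk : ∀ (l : List E) (u w : V), Γ.IsWalk u l w →
      (∀ x y, F (Γ.walkElem u l) x y → x.1 ∈ t.boundary w ∧ y.1 ∈ t.boundary u ∧
        y.2 = x.2 + (l.map wt).sum) ∧
      ∀ x, x.1 ∈ t.boundary w → ∃ y, F (Γ.walkElem u l) x y := by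
    intro l
    induction l with
    | nil =>
      rintro u w rfl
      refine ⟨fun x y h => ?_, fun x hx => ⟨x, (hv _ _ _).2 ⟨hx, rfl⟩⟩⟩
      obtain ⟨hx, rfl⟩ := (hv _ _ _).1 h
      exact ⟨hx, hx, by simp⟩
    | cons e l ih =>
      rintro u w ⟨rfl, hl⟩
      obtain ⟨ih1, ih2⟩ := ih _ _ hl
      simp only [walkElem, map_mul, RelEnd.mul_apply]
      refine ⟨?_, fun x hx => ?_⟩
      · rintro x y ⟨z, h1, h2⟩
        obtain ⟨hx, hz, hzx⟩ := ih1 _ _ h1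
        obtain ⟨-, rfl⟩ := (he _ _ _).1 h2
        refine ⟨hx, cons_mem_boundary hz, ?_⟩
        simp only [hzx, List.map_cons, List.sum_cons]
        abel
      · obtain ⟨z, hz⟩ := ih2 x hx
        exact ⟨_, z, hz, (he _ _ _).2 ⟨(ih1 _ _ hz).2.1, rfl⟩⟩
  have hc : ∀ c : Γ.Cycle, c.In t.W → ∀ x y, F c.elem x y ↔
      x.1 ∈ t.boundary c.source ∧ y = (x.1, x.2 + (c.edges.map wt).sum) := by
    intro c hcW x y
    obtain ⟨h1, h2⟩ := hwalk _ _ _ c.isWalk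
    have key : ∀ z, F c.elem x z →
        x.1 ∈ t.boundary c.source ∧ z = (x.1, x.2 + (c.edges.map wt).sum) := by
      intro z hz
      rw [c.elem_eq] at hz
      obtain ⟨hx, hz1, hz2⟩ := h1 _ _ hz
      -- Input and output paths both lie in the one-point boundary at the source, so only the weight
      -- can change.
      exact ⟨hx, Prod.ext (boundary_cycle_subsingleton hcW hz1 hx) hz2⟩
    refine ⟨key y, ?_⟩
    rintro ⟨hx, rfl⟩
    obtain ⟨z, hz⟩ := h2 x hx
    rw [← c.elem_eq] at hz
    rwa [← (key z hz).2]
  have hcp : ∀ c : Γ.Cycle, c.In t.W → ∀ (m : ℕ+) x y, F (ppow c.elem m) x y ↔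
      x.1 ∈ t.boundary c.source ∧ y = (x.1, x.2 + (m : ℕ) • (c.edges.map wt).sum) := by
    intro c hcW m
    induction m using PNat.recOn with
    | one => intro x y; rw [ppow_one, hc c hcW, PNat.one_coe, one_smul]
    | succ m ih =>
      intro x y
      rw [ppow_succ, map_mul, RelEnd.mul_apply, PNat.add_coe, PNat.one_coe, add_smul, one_smul,
        ← add_assoc]
      constructor
      · rintro ⟨z, h1, h2⟩
        obtain ⟨hx, rfl⟩ := (ih _ _).1 h1
        exact ⟨hx, ((hc c hcW _ _).1 h2).2⟩
      · rintro ⟨hx, rfl⟩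
        exact ⟨_, (ih _ _).2 ⟨hx, rfl⟩, (hc c hcW _ _).2 ⟨hx, rfl⟩⟩
  refine ⟨F, h0, ?_, hv, fun e x y h => ?_, hcp⟩
  · refine Con.conGen_le.2 ?_
    intro a b h
    rw [Con.ker_rel]
    cases h with
    | vert_zero v hvH =>
      rw [h0]
      refine RelEnd.ext fun x y => ?_
      rw [hv, RelEnd.zero_apply, iff_false]
      exact fun h => notMem_H_of_mem_boundary h.1 hvH
    | edge_star e hsW hr =>
      refine RelEnd.ext fun x y => ?_
      rw [hes, hv]
      refine and_congr_left fun _ => ⟨?_, fun hx => ?_⟩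
      · rintro ⟨z, hz, hx⟩
        change x.1 ∈ t.boundary (Γ.s e)
        rw [hx]
        exact cons_mem_boundary hz
      -- A path at a vertex of W cannot stop and must leave through `e`, so ee* is defined on all of
      -- them.
      · rcases boundary_cases hx with ⟨-, -, h⟩ | ⟨f, hf, hfs, hfr, hx'⟩
        · exact absurd hsW h
        obtain rfl := (t.existsUnique_edge hsW).unique ⟨hfs, hfr⟩ ⟨rfl, hr⟩
        exact ⟨_, hx', by rw [← hf, Stream'.eta]⟩
    | cycle_pow c hcW m hm =>
      refine RelEnd.ext fun x y => ?_
      rw [hcp c hcW, hv, hwt c m hcW hm, add_zero]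
      rfl
  · obtain ⟨⟨z, -, hz⟩, -⟩ := (hes _ _ _).1 h
    exact ⟨z, hz⟩

/-! ### The congruence triple of the congruence of a triple -/

theorem exists_rotate (c : Γ.Cycle) (n : ℕ) : ∃ d : Γ.Cycle, d.edges = c.edges.rotate n := by
  induction n with
  | zero => exact ⟨c, by simp⟩
  | succ n ih =>
    obtain ⟨d, hd⟩ := ih
    obtain ⟨d', hd'⟩ := exists_rotate_one d
    exact ⟨d', by rw [hd', hd, List.rotate_rotate]⟩

/-- At a vertex of W only one edge avoids H, so the walks cannot diverge. -/
theorem _root_.DirectedGraph.IsWalk.prefix_or_prefix {u w w' : V} {a b : List E}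
    (ha : Γ.IsWalk u a w) (hb : Γ.IsWalk u b w') (haW : ∀ e ∈ a, Γ.s e ∈ t.W ∧ Γ.r e ∉ t.H)
    (hbH : ∀ e ∈ b, Γ.r e ∉ t.H) : a <+: b ∨ b <+: a := by
  induction a generalizing u b with
  | nil => exact Or.inl (List.nil_prefix)
  | cons e a ih =>
    cases b with
    | nil => exact Or.inr (List.nil_prefix)
    | cons f b =>
      have h := haW e List.mem_cons_self
      obtain rfl := (t.existsUnique_edge h.1).unique ⟨rfl, h.2⟩
        ⟨hb.1.trans ha.1.symm, hbH f List.mem_cons_self⟩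
      simp only [List.cons_prefix_cons, true_and]
      exact ih ha.2 hb.2 (fun g hg => haW g (List.mem_cons_of_mem _ hg))
        (fun g hg => hbH g (List.mem_cons_of_mem _ hg))

theorem cycle_range_notMem {c : Γ.Cycle} (hc : c.In t.W) {e : E} (he : e ∈ c.edges) :
    Γ.r e ∉ t.H := by
  obtain ⟨f, hf, hfe⟩ := c.isWalk.exists_source_eq_range he
  exact hfe ▸ t.notMem_H (hc f hf)

/-- A surplus edge would start at the common source again, repeating a source of `d`. -/
theorem _root_.DirectedGraph.Cycle.edges_eq_of_prefix {c d : Γ.Cycle} (h : c.edges <+: d.edges)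
    (hs : c.source = d.source) : c.edges = d.edges := by
  obtain ⟨l, hl⟩ := h
  have hw := d.isWalk
  rw [← hl, ← hs] at hw
  have hw' := c.isWalk.of_append hw
  cases l with
  | nil => rw [← hl, List.append_nil]
  | cons e l =>
    exfalso
    have hnd : (d.edges.map Γ.s).Nodup := d.nodup
    rw [← hl, List.map_append, List.nodup_append] at hnd
    exact hnd.2.2 (Γ.s c.first) (List.mem_map_of_mem List.mem_cons_self) (Γ.s e)
      (List.mem_map_of_mem List.mem_cons_self) hw'.1.symm

/-- Two cycles in `W` with a common edge are cyclic permutations of each other. -/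
theorem isRotated_of_first_mem {c d : Γ.Cycle} (hc : c.In t.W) (hd : d.In t.W)
    (h : c.first ∈ d.edges) : c.edges ~r d.edges := by
  obtain ⟨a, b, hab⟩ := List.append_of_mem h
  obtain ⟨d', hd'⟩ := exists_rotate d a.length
  have hrot : d.edges ~r d'.edges := ⟨_, hd'.symm⟩
  have hd'W : d'.In t.W := fun e he => hd e (hrot.mem_iff.2 he)
  rw [hab, List.rotate_append_length_eq] at hd'
  have hfirst : d'.first = c.first := (List.cons.inj hd').1
  have hs : d'.source = c.source := congrArg Γ.s hfirst
  have hw := d'.isWalk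
  rw [hs] at hw
  have heq : c.edges = d'.edges := by
    rcases c.isWalk.prefix_or_prefix (t := t) hw (fun e he => ⟨hc e he, cycle_range_notMem hc he⟩)
      (fun e he => cycle_range_notMem hd'W he) with h | h
    · exact Cycle.edges_eq_of_prefix h hs.symm
    · exact (Cycle.edges_eq_of_prefix h hs).symm
  rw [heq]
  exact hrot.symm

theorem conH_toCon (t : Γ.CongTriple) : conH t.toCon = t.H := by
  refine Set.Subset.antisymm (fun v hv => ?_) fun v hv => ConGen.Rel.of _ _ (.vert_zero v hv)
  by_contra hvH
  obtain ⟨F, h0, hF, hvert, -⟩ := t.exists_weighted_action (fun _ => (0 : ℤ)) (by simp)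
  obtain ⟨x, hx, -⟩ := t.exists_mem_boundary hvH
  have h1 : F (Γ.vert v) = F 0 := hF hv
  have h2 : F (Γ.vert v) (x, 0) (x, 0) := (hvert _ _ _).2 ⟨hx, rfl⟩
  rw [h1, h0] at h2
  exact h2

theorem conW_toCon (t : Γ.CongTriple) : conW t.toCon = t.W := by
  ext w
  constructor
  · rintro ⟨hw, e, rfl, -, h⟩
    rw [conH_toCon] at hw
    by_contra hW
    obtain ⟨F, h0, hF, hvert, hes, -⟩ := t.exists_weighted_action (fun _ => (0 : ℤ)) (by simp)
    obtain ⟨x, hx, hxh⟩ := t.exists_mem_boundary hw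
    have h1 : F (Γ.edge e * Γ.star e) = F (Γ.vert (Γ.s e)) := hF h
    have h2 : F (Γ.vert (Γ.s e)) (x, 0) (x, 0) := (hvert _ _ _).2 ⟨hx, rfl⟩
    rw [← h1] at h2
    obtain ⟨z, hz⟩ := hes _ _ _ h2
    have h3 := hxh hW
    -- The chosen path at s(e) begins with a vertex letter, while the domain of ee* has only paths
    -- beginning with `e`.
    rw [show x = _ from hz, Stream'.head_cons] at h3
    exact Sum.inl_ne_inr h3
  · intro hw
    obtain ⟨e, ⟨rfl, hr⟩, -⟩ := t.existsUnique_edge hw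
    refine ⟨?_, e, rfl, ?_, ConGen.Rel.of _ _ (.edge_star e hw hr)⟩ <;> rw [conH_toCon]
    · exact t.notMem_H hw
    · exact hr

/-- If `c ^ k` is identified with `s(c)`, then `k` is divisible by `f(c)`. -/
theorem dvd_of_toCon_ppow (t : Γ.CongTriple) {c : Γ.Cycle} (hc : c.In t.W) {n : ℕ}
    (hn : ∀ m : ℕ+, t.f c = m → n ∣ m) {k : ℕ+}
    (h : t.toCon (ppow c.elem k) (Γ.vert c.source)) : n ∣ k := by
  classical
  -- Weight 1 on the first edge and 0 elsewhere gives `c` total weight 1, its edges being distinct.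
  have hone : (c.edges.map fun e => if e = c.first then (1 : ZMod n) else 0).sum = 1 := by
    rw [List.sum_map_ite_eq]
    have hnd : c.edges.Nodup := List.Nodup.of_map _ c.nodup
    rw [List.count_eq_one_of_mem hnd List.mem_cons_self]
    simp
  obtain ⟨F, -, hF, hvert, -, hcp⟩ := t.exists_weighted_action
    (fun e => if e = c.first then (1 : ZMod n) else 0) (by
      intro d m hd hm
      -- A cycle in W through this edge is a rotation of `c`, so its total weight is 1 and its value
      -- of f is a multiple of n; any other has weight 0.
      by_cases hmem : c.first ∈ d.edges
      · have hrot := isRotated_of_first_mem hc hd hmem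
        rw [(hrot.perm.map _).sum_eq] at hone
        rw [hone, nsmul_one, ZMod.natCast_eq_zero_iff]
        exact hn m ((t.f_cyclic c d hc hd hrot).trans hm)
      · rw [List.sum_eq_zero, smul_zero]
        intro x hx
        obtain ⟨e, he, rfl⟩ := List.mem_map.1 hx
        exact if_neg fun (h : e = c.first) => hmem (h ▸ he))
  obtain ⟨x, hx, -⟩ := t.exists_mem_boundary
    (t.notMem_H (hc c.first List.mem_cons_self) : c.source ∉ t.H)
  have h1 : F (ppow c.elem k) = F (Γ.vert c.source) := hF h
  have h2 : F (Γ.vert c.source) (x, 0) (x, 0) := (hvert _ _ _).2 ⟨hx, rfl⟩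
  rw [← h1, hcp c hc, hone, nsmul_one, zero_add] at h2
  exact (ZMod.natCast_eq_zero_iff _ _).1 (Prod.mk.inj h2.2).2.symm

theorem conF_toCon (t : Γ.CongTriple) (c : Γ.Cycle) : conF t.toCon c = t.f c := by
  rw [conF, conH_toCon, conW_toCon]
  split_ifs with hH hW
  · exact (t.f_H c hH).symm
  · cases hf : t.f c with
    | top =>
      refine leastOrTop_eq_top fun k hk => k.ne_zero ?_
      -- For f(c) = ∞ take n = 0: the weights lie in `ZMod 0`, that is ℤ, and no positive k is
      -- divisible by 0.
      exact Nat.eq_zero_of_zero_dvd (t.dvd_of_toCon_ppow hW (n := 0) (by simp [hf]) hk)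
    | coe m =>
      refine leastOrTop_eq_coe (ConGen.Rel.of _ _ (.cycle_pow c hW m hf)) fun k hk => ?_
      refine PNat.le_of_dvd (PNat.dvd_iff.2 (t.dvd_of_toCon_ppow hW (fun m' hm' => ?_) hk))
      rw [hf] at hm'
      rw [WithTop.coe_injective hm']
  · exact (t.f_otherwise c hH hW).symm

theorem toTriple_toCon (t : Γ.CongTriple) : Γ.toTriple t.toCon = t :=
  CongTriple.ext (conH_toCon t) (conW_toCon t) (funext (conF_toCon t))

/-! ### The order isomorphism -/

/-- Heredity carries membership along the cycle to its base point, and from there once around. -/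
theorem cycle_in_of_source_mem {H : Set V} (hH : Γ.Hereditary H) {c : Γ.Cycle}
    (h : ∃ e ∈ c.edges, Γ.s e ∈ H) : c.In H := by
  have key : ∀ (l : List E) (u w : V), Γ.IsWalk u l w → u ∈ H → (∀ e ∈ l, Γ.s e ∈ H) ∧ w ∈ H := by
    intro l
    induction l with
    | nil => rintro u w rfl hu; exact ⟨by simp, hu⟩
    | cons e l ih =>
      rintro u w ⟨rfl, hl⟩ hu
      obtain ⟨h1, h2⟩ := ih _ _ hl (hH e hu)
      refine ⟨fun f hf => ?_, h2⟩
      rcases List.mem_cons.1 hf with rfl | hf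
      · exact hu
      · exact h1 f hf
  obtain ⟨e, he, hes⟩ := h
  obtain ⟨a, b, hab⟩ := List.append_of_mem he
  have hw := c.isWalk
  rw [hab] at hw
  obtain ⟨v, -, hv⟩ := isWalk_append.1 hw
  obtain rfl : Γ.s e = v := hv.1
  exact (key _ _ _ c.isWalk (key _ _ _ hv hes).2).1

theorem toCon_mono {t₁ t₂ : Γ.CongTriple} (h : t₁ ≤ t₂) : t₁.toCon ≤ t₂.toCon := by
  obtain ⟨hH, hW, hf⟩ := h
  have hz : ∀ {v}, v ∈ t₂.H → t₂.toCon (Γ.vert v) 0 := fun hv =>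
    ConGen.Rel.of _ _ (.vert_zero _ hv)
  refine Con.conGen_le.2 ?_
  intro x y hxy
  cases hxy with
  | vert_zero v hv => exact hz (hH hv)
  | edge_star e hs hr =>
    by_cases hs2 : Γ.s e ∈ t₂.H
    · refine Con.trans _ ?_ (Con.symm _ (hz hs2))
      rw [← vert_mul_edge, mul_assoc]
      exact con_mul_zero _ (hz hs2)
    · have hsW := hW ⟨hs, hs2⟩
      obtain ⟨g, ⟨hgs, hgr⟩, -⟩ := t₂.existsUnique_edge hsW
      -- The edge that `t₂` singles out also avoids the smaller set `t₁.H`, so it is the edge of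
      -- `t₁`.
      obtain rfl := (t₁.existsUnique_edge hs).unique ⟨hgs, fun h => hgr (hH h)⟩ ⟨rfl, hr⟩
      exact ConGen.Rel.of _ _ (.edge_star g hsW hgr)
  | cycle_pow c hc m hm =>
    by_cases hcH : c.In t₂.H
    · have h0 := hz (hcH c.first List.mem_cons_self : c.source ∈ t₂.H)
      refine Con.trans _ ?_ (Con.symm _ h0)
      rw [← ppow_left _ _ c.vert_mul_elem]
      exact con_mul_zero _ h0
    · rcases hf c with h | ⟨a, b, ha, hb, hab⟩
      · exact absurd (hm.symm.trans h) WithTop.coe_ne_top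
      · obtain rfl := WithTop.coe_injective (hm.symm.trans hb)
        -- Outside H and W the extended function is ∞, so a finite value forces the cycle into W.
        have hcW : c.In t₂.W := by
          by_contra hcW
          rw [t₂.f_otherwise c hcH hcW] at ha
          exact WithTop.coe_ne_top ha.symm
        exact con_ppow_of_dvd _ (ConGen.Rel.of _ _ (.cycle_pow c hcW a ha)) hab

end CongTriple

theorem toTriple_mono {ρ₁ ρ₂ : Con Γ.InvSemigroup} (h : ρ₁ ≤ ρ₂) :
    Γ.toTriple ρ₁ ≤ Γ.toTriple ρ₂ := by
  have hH : conH ρ₁ ⊆ conH ρ₂ := fun v hv => h hv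
  have hW : conW ρ₁ \ conH ρ₂ ⊆ conW ρ₂ := by
    rintro w ⟨⟨-, e, rfl, -, he⟩, hw⟩
    exact (toCon_toTriple_edge hw (h he)).2
  refine ⟨hH, hW, fun c => ?_⟩
  change ExtDvd (conF ρ₂ c) (conF ρ₁ c)
  by_cases h2 : c.In (conH ρ₂)
  · have : conF ρ₂ c = 1 := (Γ.toTriple ρ₂).f_H c h2
    rw [this]
    cases conF ρ₁ c with
    | top => exact Or.inl rfl
    | coe m => exact Or.inr ⟨1, m, rfl, rfl, one_dvd m⟩
  have h1 : ¬ c.In (conH ρ₁) := fun h1 => h2 fun e he => hH (h1 e he)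
  by_cases hc : c.In (conW ρ₁)
  -- A single vertex in the larger H would put the whole cycle there.
  · have hc2 : c.In (conW ρ₂) := fun e he => hW ⟨hc e he, fun hes =>
      h2 (CongTriple.cycle_in_of_source_mem (conH_hereditary ρ₂) ⟨e, he, hes⟩)⟩
    rw [conF_of_in_conW hc, conF_of_in_conW hc2]
    cases hm : conOrder ρ₁ c with
    | top => exact Or.inl rfl
    | coe m =>
      obtain ⟨k, hk, hkm⟩ := conOrder_dvd ρ₂ c (h (leastOrTop_spec hm))
      exact Or.inr ⟨k, m, hk, rfl, hkm⟩
  · exact Or.inl ((Γ.toTriple ρ₁).f_otherwise c h1 hc)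

end DirectedGraph

theorem mainTheorem2 {V : Type*} {E : Type*} (Γ : DirectedGraph V E) :
    ∃ φ : Γ.CongTriple ≃o Con Γ.InvSemigroup,
      (∀ t : Γ.CongTriple, φ t = t.toCon) ∧
      (∀ ρ : Con Γ.InvSemigroup, φ.symm ρ = Γ.toTriple ρ) := by
  refine ⟨⟨⟨fun t => t.toCon, Γ.toTriple, DirectedGraph.CongTriple.toTriple_toCon,
    DirectedGraph.toCon_toTriple⟩, fun {t₁ t₂} => ⟨fun h => ?_, ?_⟩⟩, fun _ => rfl, fun _ => rfl⟩
  -- Order reflection for ℘ is monotonicity of its inverse T.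
  · have := DirectedGraph.toTriple_mono h
    simpa only [Equiv.coe_fn_mk, DirectedGraph.CongTriple.toTriple_toCon] using this
  · exact DirectedGraph.CongTriple.toCon_mono
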